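/- Let $\Bbbk$ be a field of characteristic zero, let $S=\Bbbk[x,y]$ be the algebra of polynomial functions on the plane $\Bbbk^2$, and let $S_1$ be the space of homogeneous polynomials of degree $1$. Let $r\geq-1$ be an integer, let $\mathcal A$ be a central arrangement of $r+2$ lines in $\Bbbk^2$ (a set of $r+2$ distinct lines through the origin), and let $Q\in S$ be a defining polynomial of $\mathcal A$, that is, a square-free product of elements of $S_1$ whose zero locus is the union of the lines of $\mathcal A$. Let $\operatorname{Der}(\mathcal A)=\{\delta\in\operatorname{Der}_{\Bbbk}(S):\delta(Q)\in QS\}$, and let $A=\mathcal D(\mathcal A)$ be the subalgebra of $\operatorname{End}_{\Bbbk}(S)$ generated by the multiplications by elements of $S$ (identified with $S$) and by $\operatorname{Der}(\mathcal A)$. Let $HH^1(A)$ be the first Hochschild cohomology space of $A$, viewed as the space of outer derivations of $A$: the $\Bbbk$-linear derivations $A\to A$ modulo the inner ones. 1. If $\alpha$ is a non-zero element of $S_1$ that divides $Q$, then $\alpha$ divides $\delta(\alpha)$ in $S$ for all $\delta\in\operatorname{Der}(\mathcal A)$, and there exists a unique $\Bbbk$-linear derivation $\partial_\alpha:A\to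 A$ such that $\partial_\alpha(f)=0$ for all $f\in S$ and $$\partial_\alpha(\delta)=\frac{\delta(\alpha)}{\alpha}\quad\text{for all }\delta\in\operatorname{Der}(\mathcal A).$$ 2. If $Q=\alpha_0\cdots\alpha_{r+1}$ is a factorization of $Q$ as a product of elements of $S_1$, then the classes of the $r+2$ derivations $\partial_{\alpha_0},\dots,\partial_{\alpha_{r+1}}$ form a basis of the $\Bbbk$-vector space $HH^1(A)$. -/

import Mathlib

set_option maxSynthPendingDepth 3

open MvPolynomial

noncomputable section

namespace LineArrangement

universe u v

/-! ### Outer derivations of an associative algebra -/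

section Outer

variable (k : Type u) [CommRing k] (A : Type v) [Ring A] [Algebra k A]

/-- The `k`-module of `k`-linear derivations `A → A` of a (not necessarily commutative)
`k`-algebra `A`, that is, of `1`-cocycles of the Hochschild cochain complex of `A` with
coefficients in `A`. -/
def algDer : Submodule k (A →ₗ[k] A) where
  carrier := {d | ∀ a b : A, d (a * b) = d a * b + a * d b}
  zero_mem' := by intro a b; simp
  add_mem' := by
    intro d e hd he a b
    simp only [LinearMap.add_apply, hd a b, he a b, add_mul, mul_add]
    abel
  smul_mem' := by
    intro c d hd a b
    simp only [LinearMap.smul_apply, hd a b, smul_add, smul_mul_assoc, mul_smul_comm]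

/-- The inner derivation `ad c : a ↦ c * a - a * c`. -/
def adDer (c : A) : algDer k A :=
  ⟨LinearMap.mulLeft k c - LinearMap.mulRight k c, by
    intro a b
    simp only [LinearMap.sub_apply, LinearMap.mulLeft_apply, LinearMap.mulRight_apply]
    noncomm_ring⟩

/-- The submodule of inner derivations, that is, of `1`-coboundaries of the Hochschild cochain
complex. -/
def innerDer : Submodule k (algDer k A) where
  carrier := {d | ∃ c : A, d = adDer k A c}
  zero_mem' := ⟨0, by ext a; simp [adDer]⟩
  add_mem' := by
    rintro _ _ ⟨c, rfl⟩ ⟨e, rfl⟩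
    refine ⟨c + e, ?_⟩
    ext a
    simp only [adDer, Submodule.coe_add, LinearMap.add_apply, LinearMap.sub_apply,
      LinearMap.mulLeft_apply, LinearMap.mulRight_apply]
    noncomm_ring
  smul_mem' := by
    rintro t _ ⟨c, rfl⟩
    refine ⟨t • c, ?_⟩
    ext a
    simp [adDer, smul_sub]

/-- The first Hochschild cohomology space `HH¹(A)`, as the space of outer derivations:
derivations modulo inner derivations. -/
abbrev HH1 : Type v := algDer k A ⧸ innerDer k A

end Outer

/-! ### Central line arrangements in the plane and their algebras of differential operators -/

section Arrangement

variable (k : Type u) [Field k]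

/-- The algebra `S = k[x, y]` of polynomial functions on the plane. -/
abbrev S : Type u := MvPolynomial (Fin 2) k

/-- A central arrangement of lines in the plane `k²`: a finite set of lines through the
origin. -/
structure CentralArrangement where
  lines : Finset (Submodule k (Fin 2 → k))
  finrank_eq_one : ∀ L ∈ lines, Module.finrank k L = 1

variable {k}

/-- `Q` is a defining polynomial of the arrangement `𝒜`: a square-free product of linear forms
whose zero locus is the union of the lines of `𝒜`. -/
structure CentralArrangement.IsDefiningPolynomial (𝒜 : CentralArrangement k) (Q : S k) :
    Prop where
  squarefree : Squarefree Q
  exists_factors : ∃ s : Multiset (S k), (∀ a ∈ s, a.IsHomogeneous 1) ∧ Q = s.prod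
  eval_eq_zero_iff : ∀ p : Fin 2 → k, eval p Q = 0 ↔ ∃ L ∈ 𝒜.lines, p ∈ L

/-- The module `Der(𝒜)` of derivations `δ` of `S` with `δ(Q) ∈ QS`. -/
def logDer (Q : S k) : Submodule (S k) (Derivation k (S k) (S k)) where
  carrier := {δ | δ Q ∈ Ideal.span {Q}}
  zero_mem' := by simp
  add_mem' := by
    intro δ ε hδ hε
    simpa using add_mem hδ hε
  smul_mem' := by
    intro f δ hδ
    simpa using Ideal.mul_mem_left _ f hδ

/-- The algebra `D(𝒜)` of differential operators tangent to the arrangement: the subalgebra of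
`End_k(S)` generated by the multiplications by elements of `S` and by `Der(𝒜)`. -/
def diffOps (Q : S k) : Subalgebra k (Module.End k (S k)) :=
  Algebra.adjoin k
    (Set.range (fun f : S k => LinearMap.mulLeft k f) ∪
      {T | ∃ δ ∈ logDer Q, T = (δ : S k →ₗ[k] S k)})

/-- An element of `S` viewed in `D(𝒜)`, as a multiplication operator. -/
def ofPoly (Q : S k) (f : S k) : diffOps Q :=
  ⟨LinearMap.mulLeft k f, Algebra.subset_adjoin (Or.inl ⟨f, rfl⟩)⟩

/-- An element of `Der(𝒜)` viewed in `D(𝒜)`. -/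
def ofDer (Q : S k) (δ : logDer Q) : diffOps Q :=
  ⟨((δ : Derivation k (S k) (S k)) : S k →ₗ[k] S k),
    Algebra.subset_adjoin (Or.inr ⟨δ, δ.2, rfl⟩)⟩

/-- The derivation `d` of `D(𝒜)` vanishes on `S`, and for all `δ ∈ Der(𝒜)` the polynomial `α`
divides `δ(α)` and `d(δ) = δ(α) / α`. -/
def IsPartial (Q α : S k) (d : algDer k (diffOps Q)) : Prop :=
  (∀ f : S k, (d : diffOps Q →ₗ[k] diffOps Q) (ofPoly Q f) = 0) ∧
    ∀ δ : logDer Q, ∃ g : S k, (δ : Derivation k (S k) (S k)) α = α * g ∧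
      (d : diffOps Q →ₗ[k] diffOps Q) (ofDer Q δ) = ofPoly Q g

end Arrangement

end LineArrangement

end

noncomputable section

namespace LineArrangement

universe u v

/-! ### Polynomial families of vectors -/

/-! Formally `∂_α` is `ad (log α)` up to sign. For `T` in `D(𝒜)` the conjugate `α⁻ᵐ T αᵐ` is
polynomial in `m` with coefficients in `D(𝒜)`: on generators, `f` is fixed and `δ` becomes `δ + m
δ(α)/α`. The resulting map from `D(𝒜)` to `D(𝒜)[X]` is a ring homomorphism with constant term the
identity, so its linear coefficient is a derivation, and it is `∂_α` (`exists_isPartial`).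
Uniqueness is clear on generators.

Independence: if `∑ cᵢ ∂_αᵢ` is inner, it is the bracket with an operator commuting with `S`, hence
with a polynomial `h`. Its value on the Euler derivation `E` forces `h` to be constant, and its
value on `Q ∂/∂αⱼ`, read modulo `αⱼ`, gives `cⱼ = 0` (`linearIndependent_partial`).

Spanning: write `Q = xF` with `x` one of the factors, complete `x` to coordinates `x, y`, and put `D
= F ∂/∂y`. Then `E` and `D` generate `Der(𝒜)` over `S`, and each element of `D(𝒜)` is a sum `∑ aⱼ
Eʲ` with `aⱼ` in `∑ S Dⁱ`. The crucial point is `raises_apply_ofPoly`: for every derivation `d` and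
every linear factor `α`, the operator `d(α)` maps `αᵐ S` into `αᵐ⁺¹ S`. For `α = x` this makes
`d(x)` a sum of terms `x bⱼ Eʲ`, which are brackets with `x`, so one may assume `d(x) = 0`. Then
`d(y)` lies in `∑ S Dⁱ`; the factors `αᵢ` of `F` show that its coefficients are divisible by `F`, so
it is a bracket with `y` of an operator commuting with `x`, and one may assume that `d` kills `S`.
Now `d(E)` and `d(D)` are polynomials; a bracket with a polynomial makes `d(E)` constant, and `[E,
D] = (N - 1) D` makes `d(D)` homogeneous of degree `N - 1`, where `N = deg F`. The products `F/αᵢ`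
span that degree, and they are the values on `D` of the `∂_αᵢ` up to scalars.

Throughout, characteristic zero serves to separate powers of an integer parameter `m`
(`coeff_mem_of_forall_sum_mem`) and to divide by positive integers. -/

/-- If the values of a polynomial with coefficients in a vector space lie in a subspace for
infinitely many integers, then so do its coefficients. -/
theorem coeff_mem_of_forall_sum_mem {k V : Type*} [Field k] [CharZero k] [AddCommGroup V]
    [Module k V] (W : Submodule k V) (s : Finset ℕ) (v : ℕ → V) (n : ℕ)
    (h : ∀ m : ℕ, ∑ j ∈ s, ((m + n : ℕ) : k) ^ j • v j ∈ W) : ∀ j ∈ s, v j ∈ W := by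
  intro j hj
  rw [← Submodule.Quotient.mk_eq_zero, ← Module.forall_dual_apply_eq_zero_iff k]
  intro φ
  set p : Polynomial k := ∑ i ∈ s, Polynomial.monomial i (φ (W.mkQ (v i))) with hp
  have hp0 : p = 0 := by
    refine Polynomial.eq_of_infinite_eval_eq _ _ (Set.Infinite.mono (s := Set.range
      fun m : ℕ => ((m + n : ℕ) : k)) ?_ (Set.infinite_range_of_injective fun a b hab => by
        simpa using hab))
    rintro _ ⟨m, rfl⟩
    have := (Submodule.Quotient.mk_eq_zero W).2 (h m)
    have h2 := congrArg φ this
    rw [← Submodule.mkQ_apply] at h2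
    simp only [map_sum, map_smul, smul_eq_mul, map_zero] at h2
    simp only [Set.mem_ofPred_eq, hp, Polynomial.eval_finsetSum, Polynomial.eval_monomial,
      Polynomial.eval_zero, ← h2]
    exact Finset.sum_congr rfl fun i _ => mul_comm _ _
  have := congrArg (fun q => Polynomial.coeff q j) hp0
  simpa [hp, Polynomial.finsetSum_coeff, Polynomial.coeff_monomial, hj] using this

/-! ### Generalities on algebra derivations -/

section Outer

variable {k : Type u} [CommRing k] {A : Type v} [Ring A] [Algebra k A]

instance : CoeFun (algDer k A) (fun _ => A → A) := ⟨fun d => (d : A →ₗ[k] A)⟩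

theorem algDer_mul (d : algDer k A) (a b : A) : d (a * b) = d a * b + a * d b := d.2 a b

theorem algDer_add_apply (d e : algDer k A) (a : A) : (d + e) a = d a + e a := rfl

theorem algDer_sub_apply (d e : algDer k A) (a : A) : (d - e) a = d a - e a := rfl

theorem algDer_smul_apply (c : k) (d : algDer k A) (a : A) : (c • d) a = c • d a := rfl

theorem algDer_one (d : algDer k A) : d 1 = 0 := by
  have := algDer_mul d 1 1
  simpa using this

theorem algDer_algebraMap (d : algDer k A) (c : k) : d (algebraMap k A c) = 0 := by
  rw [Algebra.algebraMap_eq_smul_one, map_smul, algDer_one, smul_zero]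

theorem adDer_apply (c a : A) : adDer k A c a = c * a - a * c := rfl

theorem sub_adDer_add_apply (d : algDer k A) (u v a : A) :
    (d - adDer k A (u + v)) a = (d - adDer k A u) a - (v * a - a * v) := by
  rw [algDer_sub_apply, algDer_sub_apply, adDer_apply, adDer_apply]
  noncomm_ring

theorem exists_sub_sum_mem_innerDer {N : ℕ} {d : Fin (N + 1) → algDer k A} {e : algDer k A}
    {w : A} {c : k} {γ : Fin N → k}
    (h : e - adDer k A w = c • d 0 + ∑ i, γ i • d i.succ) :
    ∃ c : Fin (N + 1) → k, e - ∑ i, c i • d i ∈ innerDer k A := by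
  refine ⟨Fin.cons c γ, w, ?_⟩
  rw [Fin.sum_univ_succ, Fin.cons_zero]
  simp only [Fin.cons_succ]
  rw [← h, sub_sub_cancel]

theorem algDer_commutator (d : algDer k A) (a b : A) :
    d (a * b - b * a) = (d a * b - b * d a) + (a * d b - d b * a) := by
  rw [map_sub, algDer_mul, algDer_mul]
  abel

end Outer

/-! ### Generators of `D(𝒜)` and their commutation relations -/

section Arrangement

variable {k : Type u} [Field k]

theorem ofPoly_coe_apply (Q f p : S k) : (ofPoly Q f : Module.End k (S k)) p = f * p := rfl

theorem ofDer_coe_apply (Q : S k) (δ : logDer Q) (p : S k) :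
    (ofDer Q δ : Module.End k (S k)) p = (δ : Derivation k (S k) (S k)) p := rfl

theorem diffOps_ext {Q : S k} {T U : diffOps Q}
    (h : ∀ p, (T : Module.End k (S k)) p = (U : Module.End k (S k)) p) : T = U :=
  Subtype.ext (LinearMap.ext h)

theorem diffOps_coe_mul_apply {Q : S k} (T U : diffOps Q) (p : S k) :
    ((T * U : diffOps Q) : Module.End k (S k)) p =
      (T : Module.End k (S k)) ((U : Module.End k (S k)) p) := rfl

theorem ofPoly_mul (Q f g : S k) : ofPoly Q (f * g) = ofPoly Q f * ofPoly Q g :=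
  diffOps_ext fun p => by simp [ofPoly_coe_apply, mul_assoc]

theorem ofPoly_add (Q f g : S k) : ofPoly Q (f + g) = ofPoly Q f + ofPoly Q g :=
  diffOps_ext fun p => by simp [ofPoly_coe_apply, add_mul]

theorem ofPoly_sub (Q f g : S k) : ofPoly Q (f - g) = ofPoly Q f - ofPoly Q g :=
  diffOps_ext fun p => by simp [ofPoly_coe_apply, sub_mul]

theorem ofPoly_smul (Q f : S k) (c : k) : ofPoly Q (c • f) = c • ofPoly Q f :=
  diffOps_ext fun p => by simp [ofPoly_coe_apply]

theorem ofPoly_sum {ι : Type*} (Q : S k) (s : Finset ι) (f : ι → S k) :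
    ofPoly Q (∑ i ∈ s, f i) = ∑ i ∈ s, ofPoly Q (f i) := by
  classical
  induction s using Finset.induction_on with
  | empty => exact diffOps_ext fun p => by simp [ofPoly_coe_apply]
  | insert a s ha ih => rw [Finset.sum_insert ha, Finset.sum_insert ha, ofPoly_add, ih]

theorem ofPoly_C (Q : S k) (c : k) : ofPoly Q (C c) = algebraMap k _ c :=
  diffOps_ext fun p => by
    simp [ofPoly_coe_apply, Module.algebraMap_end_apply,
      MvPolynomial.smul_eq_C_mul]

theorem ofPoly_injective (Q : S k) : Function.Injective (ofPoly Q) := fun f g h => by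
  have := congrArg (fun T : diffOps Q => (T : Module.End k (S k)) 1) h
  simpa [ofPoly_coe_apply] using this

theorem ofDer_commutator (Q : S k) (δ : logDer Q) (f : S k) :
    ofDer Q δ * ofPoly Q f - ofPoly Q f * ofDer Q δ =
      ofPoly Q ((δ : Derivation k (S k) (S k)) f) :=
  diffOps_ext fun p => by
    simp [ofPoly_coe_apply, ofDer_coe_apply, mul_comm]

theorem ofDer_add (Q : S k) (δ ε : logDer Q) : ofDer Q (δ + ε) = ofDer Q δ + ofDer Q ε :=
  diffOps_ext fun p => by simp [ofDer_coe_apply]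

theorem ofDer_smul (Q f : S k) (δ : logDer Q) : ofDer Q (f • δ) = ofPoly Q f * ofDer Q δ :=
  diffOps_ext fun p => by simp [ofDer_coe_apply, ofPoly_coe_apply]

theorem diffOps_induction {Q : S k} {p : diffOps Q → Prop} (poly : ∀ f, p (ofPoly Q f))
    (der : ∀ δ, p (ofDer Q δ)) (add : ∀ a b, p a → p b → p (a + b))
    (mul : ∀ a b, p a → p b → p (a * b)) (T : diffOps Q) : p T := by
  obtain ⟨T, hT⟩ := T
  refine Algebra.adjoin_induction (p := fun T hT => p ⟨T, hT⟩) ?_ ?_ ?_ ?_ hT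
  · rintro x (⟨f, rfl⟩ | ⟨δ, hδ, rfl⟩)
    · exact poly f
    · exact der ⟨δ, hδ⟩
  · intro r
    have := poly (C r)
    rw [ofPoly_C] at this
    exact this
  · exact fun x y hx hy h1 h2 => add _ _ h1 h2
  · exact fun x y hx hy h1 h2 => mul _ _ h1 h2

theorem algDer_ext {Q : S k} {d e : algDer k (diffOps Q)}
    (poly : ∀ f, d (ofPoly Q f) = e (ofPoly Q f))
    (der : ∀ δ, d (ofDer Q δ) = e (ofDer Q δ)) : d = e := by
  refine Subtype.ext (LinearMap.ext fun T => ?_)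
  induction T using diffOps_induction with
  | poly f => exact poly f
  | der δ => exact der δ
  | add a b ha hb => rw [map_add, map_add, ha, hb]
  | mul a b ha hb => rw [algDer_mul, algDer_mul, ha, hb]

/-- An operator commuting with all polynomials is the multiplication by its value at `1`. -/
theorem eq_ofPoly_of_forall_commute {Q : S k} {T : diffOps Q}
    (h : ∀ f, T * ofPoly Q f = ofPoly Q f * T) :
    T = ofPoly Q ((T : Module.End k (S k)) 1) :=
  diffOps_ext fun p => by
    have := congrArg (fun T : diffOps Q => (T : Module.End k (S k)) 1) (h p)
    simpa [diffOps_coe_mul_apply, ofPoly_coe_apply, mul_comm] using this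

theorem dvd_apply_of_mem_logDer {Q α : S k} (hQ : Squarefree Q) (hα : α ∣ Q)
    {δ : Derivation k (S k) (S k)} (hδ : δ ∈ logDer Q) : α ∣ δ α := by
  obtain ⟨β, rfl⟩ := hα
  have h1 : α * β ∣ δ (α * β) := Ideal.mem_span_singleton.1 hδ
  -- Modulo `α`, the Leibniz rule leaves only `δ(α)β`; square-freeness makes `α` and `β` coprime.
  have h2 : α ∣ δ α * β := by
    rw [Derivation.leibniz, smul_eq_mul, smul_eq_mul] at h1
    have := (dvd_add_right (dvd_mul_right α (δ β))).1 (dvd_of_mul_right_dvd h1)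
    rwa [mul_comm] at this
  exact (squarefree_mul_iff.1 hQ).1.dvd_of_dvd_mul_right h2

/-! ### Existence and uniqueness of `∂_α` -/

/-- Evaluation at a natural number of polynomials over a non-commutative ring. -/
def natEval (A : Type*) [Ring A] (m : ℕ) : Polynomial A →+* A :=
  Polynomial.eval₂RingHom' (RingHom.id A) (m : A) fun a => (Nat.cast_commute m a).symm

theorem natEval_eq_sum {A : Type*} [Ring A] (m : ℕ) (P : Polynomial A) :
    natEval A m P = ∑ j ∈ P.support, P.coeff j * (m : A) ^ j := by
  simp [natEval, Polynomial.eval₂RingHom', Polynomial.eval₂_eq_sum, Polynomial.sum_def]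

/-- The values `P(m)` are the conjugates `α⁻ᵐ P(0) αᵐ`. -/
def InterpolatesConj (Q α : S k) (P : Polynomial (diffOps Q)) : Prop :=
  ∀ m : ℕ, ofPoly Q (α ^ m) * natEval _ m P = P.coeff 0 * ofPoly Q (α ^ m)

/-- Since `S` is a domain, cancelling `αᵐ` gives `P(m) = 0` for every natural `m`, and a polynomial
with infinitely many zeros in `k` vanishes. -/
theorem InterpolatesConj.eq_zero [CharZero k] {Q α : S k} (hα : α ≠ 0) {P : Polynomial (diffOps Q)}
    (hP : InterpolatesConj Q α P) (h0 : P.coeff 0 = 0) : P = 0 := by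
  have h : ∀ p : S k, ∀ j ∈ P.support,
      (P.coeff j : Module.End k (S k)) p ∈ (⊥ : Submodule k (S k)) := by
    intro p
    refine coeff_mem_of_forall_sum_mem _ _ (fun j => (P.coeff j : Module.End k (S k)) p) 0 ?_
    intro m
    have h1 := congrArg (fun T : diffOps Q => (T : Module.End k (S k)) p) (hP m)
    rw [h0, zero_mul] at h1
    simp only [diffOps_coe_mul_apply, ofPoly_coe_apply, ZeroMemClass.coe_zero,
      LinearMap.zero_apply, mul_eq_zero, pow_eq_zero_iff', hα, false_and, false_or] at h1
    rw [natEval_eq_sum] at h1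
    rw [Submodule.mem_bot, ← h1, AddSubmonoidClass.coe_finsetSum, LinearMap.sum_apply]
    refine Finset.sum_congr rfl fun j _ => ?_
    have : ((m : diffOps Q) ^ j) = algebraMap k _ ((m : k) ^ j) := by simp
    rw [this, ← Algebra.commutes, ← Algebra.smul_def]
    rfl
  ext j : 1
  rw [Polynomial.coeff_zero]
  by_contra hj
  exact hj (diffOps_ext fun p => (Submodule.mem_bot k).1 (h p j (Polynomial.mem_support_iff.2 hj)))

theorem InterpolatesConj.add {Q α : S k} {P R : Polynomial (diffOps Q)}
    (hP : InterpolatesConj Q α P) (hR : InterpolatesConj Q α R) :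
    InterpolatesConj Q α (P + R) := fun m => by
  rw [map_add, mul_add, hP m, hR m, Polynomial.coeff_add, add_mul]

theorem InterpolatesConj.mul {Q α : S k} {P R : Polynomial (diffOps Q)}
    (hP : InterpolatesConj Q α P) (hR : InterpolatesConj Q α R) :
    InterpolatesConj Q α (P * R) := fun m => by
  rw [map_mul, ← mul_assoc, hP m, mul_assoc, hR m, Polynomial.mul_coeff_zero, mul_assoc]

theorem interpolatesConj_C (Q α f : S k) :
    InterpolatesConj Q α (Polynomial.C (ofPoly Q f)) := fun m => by
  simp only [natEval, Polynomial.eval₂RingHom', RingHom.coe_mk, MonoidHom.coe_mk, OneHom.coe_mk,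
    Polynomial.eval₂_C, RingHom.id_apply, Polynomial.coeff_C_zero, ← ofPoly_mul, mul_comm]

/-- This is `α⁻ᵐ δ αᵐ = δ + m δ(α)/α`. -/
theorem interpolatesConj_der {Q α g : S k} {δ : logDer Q}
    (hδ : (δ : Derivation k (S k) (S k)) α = α * g) :
    InterpolatesConj Q α (Polynomial.C (ofDer Q δ) + Polynomial.C (ofPoly Q g) * Polynomial.X) :=
  fun m => by
    have h1 : natEval (diffOps Q) m
        (Polynomial.C (ofDer Q δ) + Polynomial.C (ofPoly Q g) * Polynomial.X) =
        ofDer Q δ + ofPoly Q g * (m : diffOps Q) := by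
      rw [map_add, map_mul]
      simp [natEval, Polynomial.eval₂RingHom']
    have h2 : (δ : Derivation k (S k) (S k)) (α ^ m) = α ^ m * (m * g) := by
      rw [Derivation.leibniz_pow, hδ]
      rcases m with _ | m
      · simp
      · simp only [nsmul_eq_mul, smul_eq_mul, Nat.add_sub_cancel]
        ring
    have h3 := ofDer_commutator Q δ (α ^ m)
    rw [h2, ofPoly_mul, sub_eq_iff_eq_add] at h3
    have h4 : ofPoly Q ((m : S k) * g) = ofPoly Q g * (m : diffOps Q) := by
      have : (m : S k) = C (m : k) := by simp
      rw [mul_comm, ofPoly_mul, this, ofPoly_C]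
      simp
    rw [h1, mul_add, ← h4]
    simp [h3, add_comm]

theorem exists_interpolatesConj {Q α : S k} (hQ : Squarefree Q) (hα : α ∣ Q) (T : diffOps Q) :
    ∃ P, InterpolatesConj Q α P ∧ P.coeff 0 = T := by
  induction T using diffOps_induction with
  | poly f => exact ⟨_, interpolatesConj_C Q α f, by simp⟩
  | der δ =>
    obtain ⟨g, hg⟩ := dvd_apply_of_mem_logDer hQ hα δ.2
    exact ⟨_, interpolatesConj_der hg, by simp⟩
  | add a b ha hb =>
    obtain ⟨P, hP, rfl⟩ := ha
    obtain ⟨R, hR, rfl⟩ := hb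
    exact ⟨P + R, hP.add hR, Polynomial.coeff_add _ _ _⟩
  | mul a b ha hb =>
    obtain ⟨P, hP, rfl⟩ := ha
    obtain ⟨R, hR, rfl⟩ := hb
    exact ⟨P * R, hP.mul hR, Polynomial.mul_coeff_zero _ _⟩

theorem InterpolatesConj.eq [CharZero k] {Q α : S k} (hα : α ≠ 0) {P R : Polynomial (diffOps Q)}
    (hP : InterpolatesConj Q α P) (hR : InterpolatesConj Q α R) (h : P.coeff 0 = R.coeff 0) :
    P = R := by
  refine sub_eq_zero.1 (InterpolatesConj.eq_zero hα (fun m => ?_) (by simp [h]))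
  rw [map_sub, mul_sub, hP m, hR m, Polynomial.coeff_sub, sub_mul]

theorem InterpolatesConj.smul {Q α : S k} {P : Polynomial (diffOps Q)} (c : k)
    (hP : InterpolatesConj Q α P) : InterpolatesConj Q α (c • P) := by
  have : c • P = Polynomial.C (ofPoly Q (C c)) * P := by
    rw [ofPoly_C, ← Polynomial.algebraMap_apply, ← Algebra.smul_def]
  rw [this]
  exact (interpolatesConj_C Q α (C c)).mul hP

theorem exists_isPartial [CharZero k] {Q α : S k} (hQ : Squarefree Q) (hα : α ∣ Q) :
    ∃ d : algDer k (diffOps Q), IsPartial Q α d := by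
  have hα0 : α ≠ 0 := by
    rintro rfl
    exact hQ.ne_zero (zero_dvd_iff.1 hα)
  choose P hP hP0 using exists_interpolatesConj (Q := Q) hQ hα
  -- By uniqueness `T ↦ P T` is additive and multiplicative; comparing coefficients of `X` in `P (T
  -- U) = P T * P U` gives the Leibniz rule.
  have key : ∀ R, InterpolatesConj Q α R → P (R.coeff 0) = R := fun R hR =>
    (hP _).eq hα0 hR (hP0 _)
  refine ⟨⟨{ toFun := fun T => (P T).coeff 1, map_add' := ?_, map_smul' := ?_ }, ?_⟩, ?_, ?_⟩
  · intro T U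
    have := key _ ((hP T).add (hP U))
    rw [Polynomial.coeff_add, hP0, hP0] at this
    rw [this, Polynomial.coeff_add]
  · intro c T
    have := key _ ((hP T).smul c)
    rw [Polynomial.coeff_smul, hP0] at this
    rw [this, Polynomial.coeff_smul, RingHom.id_apply]
  · intro T U
    have := key _ ((hP T).mul (hP U))
    rw [Polynomial.mul_coeff_zero, hP0, hP0] at this
    change (P (T * U)).coeff 1 = (P T).coeff 1 * U + T * (P U).coeff 1
    rw [this, Polynomial.mul_coeff_one, hP0, hP0, add_comm]
  · intro f
    have := key _ (interpolatesConj_C Q α f)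
    rw [Polynomial.coeff_C_zero] at this
    change (P (ofPoly Q f)).coeff 1 = 0
    rw [this, Polynomial.coeff_C_succ]
  · intro δ
    obtain ⟨g, hg⟩ := dvd_apply_of_mem_logDer hQ hα δ.2
    refine ⟨g, hg, ?_⟩
    have := key _ (interpolatesConj_der hg)
    rw [Polynomial.coeff_add, Polynomial.coeff_C_zero, Polynomial.coeff_mul_X_zero, add_zero]
      at this
    change (P (ofDer Q δ)).coeff 1 = _
    rw [this]
    simp [Polynomial.coeff_C_succ]

theorem IsPartial.unique {Q α : S k} (hα : α ≠ 0) {d e : algDer k (diffOps Q)}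
    (hd : IsPartial Q α d) (he : IsPartial Q α e) : d = e := by
  refine algDer_ext (fun f => by rw [hd.1, he.1]) fun δ => ?_
  obtain ⟨g, hg, h1⟩ := hd.2 δ
  obtain ⟨g', hg', h2⟩ := he.2 δ
  rw [h1, h2, mul_left_cancel₀ hα (hg.symm.trans hg')]

end Arrangement

/-! ### Operators that are polynomials in one derivation -/

section Ops

variable {k R : Type*} [Field k] [CommRing R] [Algebra k R]

/-- The commutator with the multiplication by `f`. -/
def adPoly (f : R) : Module.End k R →ₗ[R] Module.End k R where
  toFun T := T * LinearMap.mulLeft k f - f • T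
  map_add' T U := by rw [add_mul, smul_add]; abel
  map_smul' c T := by
    ext p
    simp only [LinearMap.sub_apply, Module.End.mul_apply, LinearMap.smul_apply,
      LinearMap.mulLeft_apply, smul_eq_mul, RingHom.id_apply]
    ring

theorem adPoly_apply (f : R) (T : Module.End k R) (p : R) :
    adPoly f T p = T (f * p) - f * T p := rfl

theorem adPoly_one (f : R) : adPoly f (1 : Module.End k R) = 0 := by
  ext p
  simp [adPoly_apply]

variable (D : Derivation k R R)

/-- The operators `∑ cᵢ Dⁱ` with `i < n`. -/
def opsLT (n : ℕ) : Submodule R (Module.End k R) :=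
  Submodule.span R (Set.range fun i : Fin n => ((D : R →ₗ[k] R) : Module.End k R) ^ (i : ℕ))

theorem mem_opsLT_iff {n : ℕ} {T : Module.End k R} :
    T ∈ opsLT D n ↔ ∃ c : Fin n → R,
      ∑ i, c i • ((D : R →ₗ[k] R) : Module.End k R) ^ (i : ℕ) = T :=
  Submodule.mem_span_range_iff_exists_fun R

theorem exists_range_sum_of_mem_opsLT {n : ℕ} {T : Module.End k R} (hT : T ∈ opsLT D n) :
    ∃ c : ℕ → R, T = ∑ i ∈ Finset.range n, c i • ((D : R →ₗ[k] R) : Module.End k R) ^ i := by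
  obtain ⟨c, rfl⟩ := (mem_opsLT_iff D).1 hT
  refine ⟨fun i => if h : i < n then c ⟨i, h⟩ else 0, ?_⟩
  rw [← Fin.sum_univ_eq_sum_range
    (fun i => (if h : i < n then c ⟨i, h⟩ else 0) • ((D : R →ₗ[k] R) : Module.End k R) ^ i)]
  simp

theorem opsLT_zero {T : Module.End k R} (hT : T ∈ opsLT D 0) : T = 0 := by
  obtain ⟨c, rfl⟩ := (mem_opsLT_iff D).1 hT
  simp

theorem pow_mem_opsLT {i n : ℕ} (h : i < n) :
    ((D : R →ₗ[k] R) : Module.End k R) ^ i ∈ opsLT D n :=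
  Submodule.subset_span ⟨⟨i, h⟩, rfl⟩

theorem opsLT_mono {m n : ℕ} (h : m ≤ n) : opsLT D m ≤ opsLT D n := by
  refine Submodule.span_le.2 ?_
  rintro _ ⟨i, rfl⟩
  exact pow_mem_opsLT D (i.2.trans_le h)

theorem mem_opsLT_succ {n : ℕ} {T : Module.End k R} (hT : T ∈ opsLT D (n + 1)) :
    ∃ c : R, ∃ w ∈ opsLT D n, T = c • ((D : R →ₗ[k] R) : Module.End k R) ^ n + w := by
  obtain ⟨c, rfl⟩ := (mem_opsLT_iff D).1 hT
  refine ⟨c (Fin.last n), _, (mem_opsLT_iff D).2 ⟨fun i => c i.castSucc, rfl⟩, ?_⟩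
  rw [Fin.sum_univ_castSucc, add_comm]
  simp

theorem derivation_mul_smul (f : R) (T : Module.End k R) :
    ((D : R →ₗ[k] R) : Module.End k R) * (f • T) =
      D f • T + f • (((D : R →ₗ[k] R) : Module.End k R) * T) := by
  ext p
  simp [mul_comm, add_comm]

theorem derivation_mul_mem_opsLT {n : ℕ} {T : Module.End k R} (hT : T ∈ opsLT D n) :
    ((D : R →ₗ[k] R) : Module.End k R) * T ∈ opsLT D (n + 1) := by
  induction hT using Submodule.span_induction with
  | mem x hx =>
    obtain ⟨i, rfl⟩ := hx
    simp only [← pow_succ']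
    exact pow_mem_opsLT D (by omega)
  | zero => rw [mul_zero]; exact zero_mem _
  | add x y _ _ hx hy => rw [mul_add]; exact add_mem hx hy
  | smul a x hx' hx =>
    rw [derivation_mul_smul]
    exact add_mem (Submodule.smul_mem _ _ (opsLT_mono D n.le_succ hx')) (Submodule.smul_mem _ _ hx)

variable {D} {y F F' : R}

/-- The commutator with `y` behaves as `F` times differentiation in the symbol `D`. The condition `D
F = F * F'` keeps the ideal `(F)` stable under `D`, so that `F` factors out of the lower terms as
well. -/
theorem adPoly_pow_succ (hy : D y = F) (hF : D F = F * F') (i : ℕ) :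
    ∃ w ∈ opsLT D i, adPoly y (((D : R →ₗ[k] R) : Module.End k R) ^ (i + 1)) =
      F • ((((i + 1 : ℕ) : R)) • ((D : R →ₗ[k] R) : Module.End k R) ^ i + w) := by
  induction i with
  | zero =>
    refine ⟨0, zero_mem _, ?_⟩
    ext p
    simp [adPoly_apply, hy, mul_comm]
  | succ i ih =>
    obtain ⟨w, hw, h⟩ := ih
    set d : Module.End k R := (D : R →ₗ[k] R) with hd
    have h1 : adPoly y (d ^ (i + 1 + 1)) = d * adPoly y (d ^ (i + 1)) + F • d ^ (i + 1) := by
      ext p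
      rw [pow_succ' d (i + 1)]
      simp only [adPoly_apply, Module.End.mul_apply, LinearMap.add_apply, LinearMap.smul_apply,
        map_sub, hd, Derivation.coeFn_coe, Derivation.leibniz, smul_eq_mul, hy]
      ring
    refine ⟨(F' * ((i + 1 : ℕ) : R)) • d ^ i + F' • w + d * w, ?_, ?_⟩
    · exact add_mem (add_mem (Submodule.smul_mem _ _ (pow_mem_opsLT D i.lt_succ_self))
        (Submodule.smul_mem _ _ (opsLT_mono D i.le_succ hw))) (derivation_mul_mem_opsLT D hw)
    · rw [h1, h, derivation_mul_smul, mul_add, derivation_mul_smul, ← hd, ← pow_succ', hF,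
        Derivation.map_natCast, zero_smul, zero_add]
      simp only [smul_add, smul_smul,
        Nat.cast_succ, add_smul, mul_add, mul_one, mul_assoc]
      abel

theorem adPoly_mem (hy : D y = F) (hF : D F = F * F') {n : ℕ} {T : Module.End k R}
    (hT : T ∈ opsLT D (n + 1)) : ∃ w ∈ opsLT D n, adPoly y T = F • w := by
  induction hT using Submodule.span_induction with
  | mem x hx =>
    obtain ⟨⟨i, hi⟩, rfl⟩ := hx
    rcases i with _ | i
    · exact ⟨0, zero_mem _, by simp [adPoly_one]⟩
    · obtain ⟨w, hw, h⟩ := adPoly_pow_succ hy hF i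
      exact ⟨_, add_mem (Submodule.smul_mem _ _ (pow_mem_opsLT D (by omega)))
        (opsLT_mono D (by omega) hw), h⟩
  | zero => exact ⟨0, zero_mem _, by simp⟩
  | add a b _ _ ha hb =>
    obtain ⟨w, hw, h⟩ := ha
    obtain ⟨w', hw', h'⟩ := hb
    exact ⟨w + w', add_mem hw hw', by rw [map_add, h, h', smul_add]⟩
  | smul a x _ hx =>
    obtain ⟨w, hw, h⟩ := hx
    exact ⟨a • w, Submodule.smul_mem _ _ hw, by rw [map_smul, h, smul_comm]⟩

theorem natCast_succ_mul_algebraMap_inv [CharZero k] (n : ℕ) :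
    ((n + 1 : ℕ) : R) * algebraMap k R ((n + 1 : ℕ) : k)⁻¹ = 1 := by
  rw [← map_natCast (algebraMap k R), ← map_mul,
    mul_inv_cancel₀ (Nat.cast_ne_zero.2 n.succ_ne_zero), map_one]

/-- Every operator in `F ∑ R Dⁱ` is a commutator with `y`. -/
theorem exists_adPoly_eq [CharZero k] (hy : D y = F) (hF : D F = F * F') {n : ℕ} :
    ∀ {T : Module.End k R}, T ∈ opsLT D n → ∃ u ∈ opsLT D (n + 1), adPoly y u = F • T := by
  induction n with
  | zero =>
    intro T hT
    exact ⟨0, zero_mem _, by simp [opsLT_zero D hT]⟩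
  | succ n ih =>
    intro T hT
    obtain ⟨c, b, hb, rfl⟩ := mem_opsLT_succ D hT
    obtain ⟨w, hw, h⟩ := adPoly_pow_succ hy hF n
    -- Dividing by `n + 1` makes the commutator of `e Dⁿ⁺¹` with `y` have leading term `F c Dⁿ`; the
    -- error has lower order and is absorbed by induction.
    set e : R := c * algebraMap k R ((n + 1 : ℕ) : k)⁻¹ with he
    obtain ⟨u, hu, h'⟩ := ih (sub_mem hb (Submodule.smul_mem _ e hw))
    refine ⟨e • ((D : R →ₗ[k] R) : Module.End k R) ^ (n + 1) + u,
      add_mem (Submodule.smul_mem _ _ (pow_mem_opsLT D (by omega)))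
        (opsLT_mono D (by omega) hu), ?_⟩
    have : e * ((n + 1 : ℕ) : R) = c := by
      rw [he, mul_assoc, mul_comm (algebraMap k R _), natCast_succ_mul_algebraMap_inv, mul_one]
    rw [map_add, map_smul, h, h', smul_comm e F, ← smul_add, smul_add e, smul_smul, this]
    congr 1
    abel

/-- Commutation with `y` preserves the property of taking values in `P`, lowers the order by one and
multiplies the leading coefficient by `(n + 1) F`, which is not in the prime `P`. At order zero,
evaluate at `1`. -/
theorem leadingCoeff_mem_of_forall_apply_mem [CharZero k] (P : Ideal R) [P.IsPrime] (hFP : F ∉ P)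
    (hy : D y = F) (hF : D F = F * F') {n : ℕ} : ∀ {c : R} {w : Module.End k R},
    w ∈ opsLT D n → (∀ p, (c • ((D : R →ₗ[k] R) : Module.End k R) ^ n + w) p ∈ P) → c ∈ P := by
  induction n with
  | zero =>
    intro c w hw h
    have := h 1
    rw [opsLT_zero D hw] at this
    simpa using this
  | succ n ih =>
    intro c w hw h
    obtain ⟨v, hv, h1⟩ := adPoly_pow_succ hy hF n
    obtain ⟨v', hv', h2⟩ := adPoly_mem hy hF hw
    have key := ih (c := c * F * ((n + 1 : ℕ) : R)) (w := (c * F) • v + F • v')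
      (add_mem (Submodule.smul_mem _ _ hv) (Submodule.smul_mem _ _ hv')) ?_
    · have h3 := (Ideal.IsPrime.mem_or_mem ‹P.IsPrime› key).resolve_right fun h4 => by
        have := P.mul_mem_right (algebraMap k R ((n + 1 : ℕ) : k)⁻¹) h4
        rw [natCast_succ_mul_algebraMap_inv] at this
        exact Ideal.IsPrime.ne_top ‹_› ((Ideal.eq_top_iff_one P).2 this)
      exact (Ideal.IsPrime.mem_or_mem ‹P.IsPrime› h3).resolve_right hFP
    · intro p
      have : (c * F * ((n + 1 : ℕ) : R)) • ((D : R →ₗ[k] R) : Module.End k R) ^ n +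
          ((c * F) • v + F • v') =
          adPoly y (c • ((D : R →ₗ[k] R) : Module.End k R) ^ (n + 1) + w) := by
        rw [map_add, map_smul, h1, h2, smul_smul, smul_add, smul_smul, add_assoc]
      rw [this, adPoly_apply]
      exact sub_mem (h _) (P.mul_mem_left _ (h _))

/-- Peel off leading coefficients one at a time, each being divisible by `x`. -/
theorem exists_smul_of_forall_dvd_apply [CharZero k] {x : R} (hx : Prime x) (hFx : ¬ x ∣ F)
    (hy : D y = F) (hF : D F = F * F') {n : ℕ} : ∀ {T : Module.End k R}, T ∈ opsLT D n →
    (∀ p, x ∣ T p) → ∃ U ∈ opsLT D n, T = x • U := by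
  have : (Ideal.span {x}).IsPrime := (Ideal.span_singleton_prime hx.ne_zero).2 hx
  induction n with
  | zero =>
    intro T hT _
    exact ⟨0, zero_mem _, by simp [opsLT_zero D hT]⟩
  | succ n ih =>
    intro T hT h
    obtain ⟨c, w, hw, rfl⟩ := mem_opsLT_succ D hT
    have hc := leadingCoeff_mem_of_forall_apply_mem (Ideal.span {x})
      (fun h => hFx (Ideal.mem_span_singleton.1 h)) hy hF hw
      fun p => Ideal.mem_span_singleton.2 (h p)
    obtain ⟨c', rfl⟩ := Ideal.mem_span_singleton.1 hc
    obtain ⟨U, hU, rfl⟩ := ih hw fun p => (dvd_add_right (by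
      simp only [LinearMap.smul_apply, smul_eq_mul, mul_assoc]
      exact dvd_mul_right x _)).1 (h p)
    exact ⟨c' • ((D : R →ₗ[k] R) : Module.End k R) ^ n + U,
      add_mem (Submodule.smul_mem _ _ (pow_mem_opsLT D n.lt_succ_self))
        (opsLT_mono D n.le_succ hU), by rw [smul_add, smul_smul]⟩

variable (D)

/-- The operators `∑ cᵢ Dⁱ`. -/
def ops : Submodule R (Module.End k R) :=
  Submodule.span R (Set.range fun i : ℕ => ((D : R →ₗ[k] R) : Module.End k R) ^ i)

theorem opsLT_le_ops (n : ℕ) : opsLT D n ≤ ops D := by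
  refine Submodule.span_le.2 ?_
  rintro _ ⟨i, rfl⟩
  exact Submodule.subset_span ⟨(i : ℕ), rfl⟩

theorem exists_mem_opsLT {T : Module.End k R} (hT : T ∈ ops D) : ∃ n, T ∈ opsLT D n := by
  induction hT using Submodule.span_induction with
  | mem x hx =>
    obtain ⟨i, rfl⟩ := hx
    exact ⟨i + 1, pow_mem_opsLT D i.lt_succ_self⟩
  | zero => exact ⟨0, zero_mem _⟩
  | add a b _ _ ha hb =>
    obtain ⟨m, hm⟩ := ha
    obtain ⟨n, hn⟩ := hb
    exact ⟨max m n, add_mem (opsLT_mono D (le_max_left _ _) hm)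
      (opsLT_mono D (le_max_right _ _) hn)⟩
  | smul a x _ hx =>
    obtain ⟨n, hn⟩ := hx
    exact ⟨n, Submodule.smul_mem _ _ hn⟩

theorem derivation_mul_mem_ops {T : Module.End k R} (hT : T ∈ ops D) :
    ((D : R →ₗ[k] R) : Module.End k R) * T ∈ ops D := by
  obtain ⟨n, hn⟩ := exists_mem_opsLT D hT
  exact opsLT_le_ops D _ (derivation_mul_mem_opsLT D hn)

/-- Operators in `∑ R Dⁱ` commute with the elements that `D` annihilates. -/
theorem ops_apply_mul {x : R} (hx : D x = 0) {T : Module.End k R} (hT : T ∈ ops D) (p : R) :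
    T (x * p) = x * T p := by
  induction hT using Submodule.span_induction generalizing p with
  | mem a ha =>
    obtain ⟨i, rfl⟩ := ha
    induction i generalizing p with
    | zero => simp
    | succ i ih =>
      simp only at ih
      simp only [pow_succ, Module.End.mul_apply]
      rw [← ih]
      simp [hx]
  | zero => simp
  | add a b _ _ ha hb => rw [LinearMap.add_apply, LinearMap.add_apply, ha, hb, mul_add]
  | smul a b _ hb =>
    rw [LinearMap.smul_apply, LinearMap.smul_apply, hb, smul_eq_mul, smul_eq_mul, mul_left_comm]

theorem ops_apply_pow_mul {x : R} (hx : D x = 0) {T : Module.End k R} (hT : T ∈ ops D)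
    (m : ℕ) (p : R) : T (x ^ m * p) = x ^ m * T p :=
  ops_apply_mul D (by rw [Derivation.leibniz_pow, hx, smul_zero, smul_zero]) hT p

/-! ### Normally ordered operators in two derivations -/

variable (E : Derivation k R R)

/-- The operators `∑ cᵢⱼ Dⁱ Eʲ`. -/
def normalOps : Submodule k (Module.End k R) :=
  ⨆ j : ℕ, ((ops D).restrictScalars k).map
    (LinearMap.mulRight k (((E : R →ₗ[k] R) : Module.End k R) ^ j))

variable {D E}

theorem mul_pow_mem_normalOps {a : Module.End k R} (ha : a ∈ ops D) (j : ℕ) :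
    a * ((E : R →ₗ[k] R) : Module.End k R) ^ j ∈ normalOps D E :=
  Submodule.mem_iSup_of_mem j ⟨a, ha, rfl⟩

theorem normalOps_induction {p : Module.End k R → Prop}
    (mem : ∀ a ∈ ops D, ∀ j : ℕ, p (a * ((E : R →ₗ[k] R) : Module.End k R) ^ j)) (zero : p 0)
    (add : ∀ a b, p a → p b → p (a + b)) {T : Module.End k R} (hT : T ∈ normalOps D E) : p T := by
  refine Submodule.iSup_induction _ (motive := p) hT ?_ zero add
  rintro j _ ⟨a, ha, rfl⟩
  exact mem a ha j

theorem exists_sum_of_mem_normalOps {T : Module.End k R} (hT : T ∈ normalOps D E) :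
    ∃ (s : Finset ℕ) (a : ℕ → Module.End k R), 0 ∈ s ∧ (∀ j, a j ∈ ops D) ∧
      T = ∑ j ∈ s, a j * ((E : R →ₗ[k] R) : Module.End k R) ^ j := by
  obtain ⟨f, hf, rfl⟩ := (Submodule.mem_iSup_iff_exists_finsupp _ _).1 hT
  choose a ha hfa using hf
  -- The index `0` is forced into the sum so that its coefficient can later be isolated in
  -- `mem_ops_of_commute`.
  refine ⟨insert 0 f.support, a, Finset.mem_insert_self _ _, ha, ?_⟩
  rw [Finsupp.sum_of_support_subset f (Finset.subset_insert 0 _) _ fun _ _ => rfl]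
  exact Finset.sum_congr rfl fun j _ => (hfa j).symm

theorem mul_left_mem_normalOps {U : Module.End k R}
    (hU : ∀ a ∈ ops D, ∀ j : ℕ, U * (a * ((E : R →ₗ[k] R) : Module.End k R) ^ j) ∈ normalOps D E)
    {T : Module.End k R} (hT : T ∈ normalOps D E) : U * T ∈ normalOps D E := by
  refine normalOps_induction (p := fun T => U * T ∈ normalOps D E) hU ?_ (fun a b ha hb => ?_) hT
  · rw [mul_zero]; exact zero_mem _
  · rw [mul_add]; exact add_mem ha hb

theorem mulLeft_mul_mem_normalOps (f : R) {T : Module.End k R} (hT : T ∈ normalOps D E) :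
    LinearMap.mulLeft k f * T ∈ normalOps D E :=
  mul_left_mem_normalOps (fun a ha j => by
    rw [← mul_assoc]
    exact mul_pow_mem_normalOps (Submodule.smul_mem (ops D) f ha) j) hT

theorem derivation_mul_mem_normalOps {T : Module.End k R} (hT : T ∈ normalOps D E) :
    ((D : R →ₗ[k] R) : Module.End k R) * T ∈ normalOps D E :=
  mul_left_mem_normalOps (fun a ha j => by
    rw [← mul_assoc]
    exact mul_pow_mem_normalOps (derivation_mul_mem_ops D ha) j) hT

/-- The relation `[E, D] = ρ D` gives `[E, Dⁱ] = iρ Dⁱ`, so moving `E` past an operator in `D`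
creates no new powers of `E`. -/
theorem commutator_mem_ops {ρ : k} (h : ∀ p, E (D p) = D (E p) + ρ • D p) {a : Module.End k R}
    (ha : a ∈ ops D) : ((E : R →ₗ[k] R) : Module.End k R) * a -
      a * ((E : R →ₗ[k] R) : Module.End k R) ∈ ops D := by
  set d : Module.End k R := (D : R →ₗ[k] R) with hd
  set e : Module.End k R := (E : R →ₗ[k] R) with he
  have hed : e * d = d * e + ρ • d := LinearMap.ext h
  induction ha using Submodule.span_induction with
  | mem x hx =>
    obtain ⟨i, rfl⟩ := hx
    have : e * d ^ i - d ^ i * e = (algebraMap k R (i * ρ)) • d ^ i := by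
      rw [algebraMap_smul]
      induction i with
      | zero => simp
      | succ i ih =>
        have : e * d ^ (i + 1) - d ^ (i + 1) * e =
            (e * d - d * e) * d ^ i + d * (e * d ^ i - d ^ i * e) := by
          rw [pow_succ']
          noncomm_ring
        rw [this, ih, hed, add_sub_cancel_left, smul_mul_assoc, ← pow_succ', mul_smul_comm,
          ← pow_succ', ← add_smul]
        congr 1
        push_cast
        ring
    simp only [← hd]
    rw [this]
    exact Submodule.smul_mem _ _ (Submodule.subset_span ⟨i, rfl⟩)
  | zero => simp
  | add a b _ _ ha hb =>
    have : e * (a + b) - (a + b) * e = (e * a - a * e) + (e * b - b * e) := by noncomm_ring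
    rw [this]
    exact add_mem ha hb
  | smul c x hx' hx =>
    have : e * (c • x) - (c • x) * e = E c • x + c • (e * x - x * e) := by
      rw [he, derivation_mul_smul, smul_mul_assoc, smul_sub]
      abel
    rw [this]
    exact add_mem (Submodule.smul_mem _ _ hx') (Submodule.smul_mem _ _ hx)

theorem euler_mul_mem_normalOps {ρ : k} (h : ∀ p, E (D p) = D (E p) + ρ • D p)
    {T : Module.End k R} (hT : T ∈ normalOps D E) :
    ((E : R →ₗ[k] R) : Module.End k R) * T ∈ normalOps D E :=
  mul_left_mem_normalOps (fun a ha j => by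
    have := add_mem (mul_pow_mem_normalOps (E := E) (commutator_mem_ops h ha) j)
      (mul_pow_mem_normalOps (E := E) ha (j + 1))
    rw [pow_succ', ← mul_assoc, ← add_mul, sub_add_cancel] at this
    rwa [← mul_assoc]) hT

end Ops

/-! ### Linear forms in two variables -/

section Linear

variable {k : Type u} [Field k]

theorem exists_eq_of_isHomogeneous_one {α : S k} (hα : α.IsHomogeneous 1) :
    ∃ a b : k, α = C a * X 0 + C b * X 1 := by
  rw [← mem_homogeneousSubmodule, homogeneousSubmodule_one_eq_span_X,
    Submodule.mem_span_range_iff_exists_fun] at hα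
  obtain ⟨c, rfl⟩ := hα
  exact ⟨c 0, c 1, by simp [Fin.sum_univ_two, smul_eq_C_mul]⟩

theorem linear_isHomogeneous (a b : k) : (C a * X 0 + C b * X 1 : S k).IsHomogeneous 1 :=
  (isHomogeneous_C_mul_X a 0).add (isHomogeneous_C_mul_X b 1)

theorem prime_of_isHomogeneous_one {α : S k} (hα : α.IsHomogeneous 1) (h0 : α ≠ 0) : Prime α := by
  refine Irreducible.prime (irreducible_of_totalDegree_eq_one (hα.totalDegree h0) fun x hx => ?_)
  obtain ⟨i, hi⟩ := ne_zero_iff.1 h0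
  exact (ne_zero_of_dvd_ne_zero hi (hx i)).isUnit

/-- A linear form completed to a coordinate system, with the dual vector fields. -/
structure Frame (x : S k) where
  y : S k
  dx : Derivation k (S k) (S k)
  dy : Derivation k (S k) (S k)
  y_hom : y.IsHomogeneous 1
  dx_x : dx x = 1
  dx_y : dx y = 0
  dy_x : dy x = 0
  dy_y : dy y = 1
  span : ∀ β : S k, β.IsHomogeneous 1 → ∃ u v : k, β = C u * x + C v * y

theorem nonempty_frame {x : S k} (hx : x.IsHomogeneous 1) (h0 : x ≠ 0) : Nonempty (Frame x) := by
  obtain ⟨a, b, rfl⟩ := exists_eq_of_isHomogeneous_one hx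
  obtain ⟨p, q, hpq⟩ : ∃ p q : k, a * q - b * p = 1 := by
    by_cases ha : a = 0
    · have hb : b ≠ 0 := fun hb => h0 (by simp [ha, hb])
      exact ⟨-b⁻¹, 0, by simp [hb]⟩
    · exact ⟨0, a⁻¹, by simp [ha]⟩
  have hC : (C a * C q - C b * C p : S k) = 1 := by rw [← C_mul, ← C_mul, ← C_sub, hpq, C_1]
  -- The rows `(a, b)` and `(p, q)` form a matrix of determinant one; the vector fields are read off
  -- its inverse.
  refine ⟨⟨C p * X 0 + C q * X 1, mkDerivation k ![C q, -C p], mkDerivation k ![-C b, C a],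
    linear_isHomogeneous p q, ?_, ?_, ?_, ?_, ?_⟩⟩
  iterate 4
    simp only [map_add, Derivation.leibniz, derivation_C, mkDerivation_X, smul_eq_mul, mul_zero,
      add_zero, Matrix.cons_val_zero, Matrix.cons_val_one]
    first
      | ring1
      | linear_combination hC
  intro β hβ
  obtain ⟨c, e, rfl⟩ := exists_eq_of_isHomogeneous_one hβ
  refine ⟨c * q - e * p, e * a - c * b, ?_⟩
  simp only [C_sub, C_mul]
  linear_combination -(C c * X 0 + C e * X 1) * hC

theorem Frame.derivation_ext {x : S k} (Φ : Frame x) {d e : Derivation k (S k) (S k)}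
    (hx : d x = e x) (hy : d Φ.y = e Φ.y) : d = e := by
  refine MvPolynomial.derivation_ext fun i => ?_
  obtain ⟨u, v, h⟩ := Φ.span (X i) (isHomogeneous_X k i)
  rw [h]
  simp [hx, hy]

theorem Frame.exists_of_isRelPrime {x : S k} (Φ : Frame x) (hx : Prime x) {β : S k}
    (hβ : β.IsHomogeneous 1) (h : IsRelPrime x β) :
    ∃ u v : k, v ≠ 0 ∧ β = C u * x + C v * Φ.y := by
  obtain ⟨u, v, huv⟩ := Φ.span β hβ
  refine ⟨u, v, ?_, huv⟩
  rintro rfl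
  refine hx.not_isUnit (h dvd_rfl ?_)
  rw [huv, C_0, zero_mul, add_zero]
  exact dvd_mul_left x _

/-! ### The Euler derivation -/

/-- The derivation `x ∂/∂x + y ∂/∂y`. -/
def euler (k : Type u) [Field k] : Derivation k (S k) (S k) := mkDerivation k X

theorem euler_apply_of_isHomogeneous {g : S k} {n : ℕ} (hg : g.IsHomogeneous n) :
    euler k g = (n : k) • g := by
  have h : euler k = ∑ i : Fin 2, (X i : S k) • pderiv i := by
    refine MvPolynomial.derivation_ext fun i => ?_
    fin_cases i <;> simp [euler, mkDerivation_X, Fin.sum_univ_two, pderiv_X]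
  rw [h, Nat.cast_smul_eq_nsmul, ← hg.sum_X_mul_pderiv]
  simp [Fin.sum_univ_two]

theorem homogeneousComponent_euler (g : S k) (m : ℕ) :
    homogeneousComponent m (euler k g) = (m : k) • homogeneousComponent m g := by
  conv_lhs => rw [← sum_homogeneousComponent g]
  conv_rhs => rw [← sum_homogeneousComponent g]
  rw [map_sum, map_sum, map_sum, Finset.smul_sum]
  refine Finset.sum_congr rfl fun i _ => ?_
  have hi := homogeneousComponent_isHomogeneous i g
  rw [euler_apply_of_isHomogeneous hi, map_smul,
    homogeneousComponent_of_mem ((mem_homogeneousSubmodule _ _).2 hi)]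
  split_ifs with h
  · rw [h]
  · simp

theorem exists_euler_eq [CharZero k] (e : S k) : ∃ (h : S k) (c : k), euler k h = e - C c := by
  -- On degree `i` the Euler derivation is multiplication by `i`, hence the inverses; the term `i =
  -- 0` disappears because `0⁻¹ = 0`.
  refine ⟨∑ i ∈ Finset.range (e.totalDegree + 1), ((i : k)⁻¹) • homogeneousComponent i e,
    coeff 0 e, ?_⟩
  have he := sum_homogeneousComponent e
  rw [Finset.sum_range_succ', homogeneousComponent_zero] at he
  rw [← eq_sub_of_add_eq he, map_sum, Finset.sum_range_succ']
  simp only [Nat.cast_zero, inv_zero, zero_smul, map_zero, add_zero]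
  refine Finset.sum_congr rfl fun i _ => ?_
  rw [Derivation.map_smul,
    euler_apply_of_isHomogeneous (homogeneousComponent_isHomogeneous _ e), smul_smul,
    inv_mul_cancel₀ (Nat.cast_ne_zero.2 i.succ_ne_zero), one_smul]

theorem homogeneousComponent_eq_zero_of_euler {g : S k} {c : k} (hg : euler k g = c • g) {m : ℕ}
    (hm : (m : k) ≠ c) : homogeneousComponent m g = 0 := by
  have h := homogeneousComponent_euler g m
  rw [hg, map_smul, ← sub_eq_zero, ← sub_smul] at h
  exact (smul_eq_zero.1 h).resolve_left fun h => hm (sub_eq_zero.1 h).symm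

theorem isHomogeneous_of_euler [CharZero k] {g : S k} {n : ℕ} (hg : euler k g = (n : k) • g) :
    g.IsHomogeneous n := by
  rw [← sum_homogeneousComponent g]
  refine IsHomogeneous.sum _ _ _ fun i _ => ?_
  by_cases h : i = n
  · rw [h]
    exact homogeneousComponent_isHomogeneous n g
  · rw [homogeneousComponent_eq_zero_of_euler hg (by simpa using h)]
    exact isHomogeneous_zero _ _ _

theorem eq_zero_of_euler_eq_neg [CharZero k] {g : S k} (hg : euler k g = (-1 : k) • g) : g = 0 := by
  rw [← sum_homogeneousComponent g]
  refine Finset.sum_eq_zero fun i _ => homogeneousComponent_eq_zero_of_euler hg fun h => ?_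
  have : ((i + 1 : ℕ) : k) = 0 := by push_cast; rw [h]; ring
  exact Nat.cast_ne_zero.2 i.succ_ne_zero this

theorem exists_eq_C_of_euler_eq_C [CharZero k] {h : S k} {c : k} (hh : euler k h = C c) :
    c = 0 ∧ ∃ e, h = C e := by
  have hc : c = 0 := by
    have := homogeneousComponent_euler h 0
    rw [hh, homogeneousComponent_of_mem (isHomogeneous_C (Fin 2) c)] at this
    simpa using this
  refine ⟨hc, coeff 0 h, ?_⟩
  have h0 : h.IsHomogeneous 0 := isHomogeneous_of_euler (by rw [hh, hc]; simp)
  rw [← homogeneousComponent_zero, homogeneousComponent_of_mem h0, if_pos rfl]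

/-! ### Interpolation of homogeneous polynomials along lines -/

/-- Modulo `α` only the variable `β` survives, so a homogeneous polynomial restricts to a multiple
of a power of `β`. -/
theorem exists_dvd_sub_pow {α β : S k}
    (hspan : ∀ l : S k, l.IsHomogeneous 1 → ∃ u v : k, l = C u * α + C v * β) {n : ℕ} {g : S k}
    (hg : g.IsHomogeneous n) : ∃ c : k, α ∣ g - C c * β ^ n := by
  rw [← mem_homogeneousSubmodule, ← homogeneousSubmodule_one_pow] at hg
  induction hg using Submodule.pow_induction_on_left' with
  | algebraMap r => exact ⟨r, by simp [algebraMap_eq]⟩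
  | add x y i _ _ hx hy =>
    obtain ⟨c, hc⟩ := hx
    obtain ⟨e, he⟩ := hy
    refine ⟨c + e, ?_⟩
    convert! dvd_add hc he using 1
    rw [C_add]
    ring
  | mem_mul m hm i x _ hx =>
    obtain ⟨c, t, ht⟩ := hx
    obtain ⟨u, v, rfl⟩ := hspan m hm
    refine ⟨v * c, C u * x + C v * β * t, ?_⟩
    rw [C_mul, Nat.succ_eq_add_one, pow_succ]
    linear_combination (C v * β) * ht

theorem isHomogeneous_of_mul [CharZero k] {α w : S k} (hα : α.IsHomogeneous 1) (h0 : α ≠ 0) {n : ℕ}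
    (h : (α * w).IsHomogeneous (n + 1)) : w.IsHomogeneous n := by
  refine isHomogeneous_of_euler (mul_left_cancel₀ h0 ?_)
  have h1 := euler_apply_of_isHomogeneous h
  rw [Derivation.leibniz, euler_apply_of_isHomogeneous hα, Nat.cast_one, one_smul] at h1
  simp only [smul_eq_mul, smul_eq_C_mul, Nat.cast_succ, C_1, C_add] at h1 ⊢
  linear_combination h1

/-- Lagrange interpolation on the lines: restricted to `αᵢ = 0` only the `i`-th product is non-zero.
Subtract the right multiple of it, divide by `αᵢ` and induct. -/
theorem exists_eq_sum_prod_erase [CharZero k] {ι : Type*} [DecidableEq ι] {α : ι → S k} {β : S k} {n : ℕ} :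
    ∀ {s : Finset ι}, s.card = n + 1 → (∀ i ∈ s, (α i).IsHomogeneous 1) → (∀ i ∈ s, α i ≠ 0) →
    (∀ i ∈ s, ∀ j ∈ s, i ≠ j → IsRelPrime (α i) (α j)) →
    (∀ i ∈ s, ∀ l : S k, l.IsHomogeneous 1 → ∃ u v : k, l = C u * α i + C v * β) →
    ∀ {g : S k}, g.IsHomogeneous n →
      ∃ γ : ι → k, g = ∑ i ∈ s, C (γ i) * ∏ j ∈ s.erase i, α j := by
  induction n with
  | zero =>
    intro s hs _ _ _ _ g hg
    obtain ⟨i, rfl⟩ := Finset.card_eq_one.1 hs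
    refine ⟨fun _ => coeff 0 g, ?_⟩
    have := homogeneousComponent_zero g
    rw [homogeneousComponent_eq_self hg] at this
    simpa using this
  | succ n ih =>
    intro s hs hα h0 hrel hspan g hg
    obtain ⟨i, t, hi, rfl, ht⟩ := Finset.card_eq_succ.1 hs
    have hprime := prime_of_isHomogeneous_one (hα i (by simp)) (h0 i (by simp))
    set P := ∏ j ∈ t, α j with hP
    have hPhom : P.IsHomogeneous (n + 1) := by
      have := IsHomogeneous.prod t α (fun _ => 1) fun j hj => hα j (by simp [hj])
      simpa [ht] using this
    obtain ⟨c, hc⟩ := exists_dvd_sub_pow (hspan i (by simp)) hg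
    obtain ⟨c', hc'⟩ := exists_dvd_sub_pow (hspan i (by simp)) hPhom
    have hc'0 : c' ≠ 0 := by
      rintro rfl
      rw [C_0, zero_mul, sub_zero] at hc'
      have : IsRelPrime (α i) P := IsRelPrime.prod_right fun j hj =>
        hrel i (by simp) j (by simp [hj]) (by rintro rfl; exact hi hj)
      exact hprime.not_isUnit (this dvd_rfl hc')
    obtain ⟨w, hw⟩ : α i ∣ g - C (c / c') * P := by
      have h1 : (C c : S k) = C (c / c') * C c' := by rw [← C_mul, div_mul_cancel₀ _ hc'0]
      have : g - C (c / c') * P = (g - C c * β ^ (n + 1)) -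
          C (c / c') * (P - C c' * β ^ (n + 1)) := by
        rw [h1]; ring
      rw [this]
      exact dvd_sub hc (hc'.mul_left _)
    have hwhom : w.IsHomogeneous n := by
      refine isHomogeneous_of_mul (hα i (by simp)) (h0 i (by simp)) ?_
      rw [← hw]
      exact hg.sub (hPhom.C_mul _)
    obtain ⟨γ, hγ⟩ := ih ht (fun j hj => hα j (by simp [hj])) (fun j hj => h0 j (by simp [hj]))
      (fun j hj l hl => hrel j (by simp [hj]) l (by simp [hl]))
      (fun j hj => hspan j (by simp [hj])) hwhom
    refine ⟨Function.update γ i (c / c'), ?_⟩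
    rw [Finset.sum_insert hi, Function.update_self, Finset.erase_insert hi, ← hP,
      eq_add_of_sub_eq' hw, hγ, Finset.mul_sum]
    congr 1
    refine Finset.sum_congr rfl fun j hj => ?_
    have hji : j ≠ i := by rintro rfl; exact hi hj
    rw [Function.update_of_ne hji, Finset.erase_insert_of_ne hji.symm, Finset.prod_insert (by
      simp [hi])]
    ring

end Linear

/-! ### First elements of `Der(𝒜)` -/

section Arrangement

variable {k : Type u} [Field k]

theorem smul_mem_logDer (Q : S k) (δ : Derivation k (S k) (S k)) : Q • δ ∈ logDer Q :=
  Ideal.mem_span_singleton.2 (dvd_mul_right Q (δ Q))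

theorem euler_mem_logDer {Q : S k} {n : ℕ} (hQ : Q.IsHomogeneous n) : euler k ∈ logDer Q := by
  refine Ideal.mem_span_singleton.2 ?_
  rw [euler_apply_of_isHomogeneous hQ, smul_eq_C_mul]
  exact dvd_mul_left Q _

theorem isRelPrime_of_squarefree_prod {ι : Type*} [Fintype ι] [DecidableEq ι] {α : ι → S k}
    (h : Squarefree (∏ i, α i)) {i j : ι} (hij : i ≠ j) : IsRelPrime (α i) (α j) := by
  rw [← Finset.mul_prod_erase _ _ (Finset.mem_univ i)] at h
  exact IsRelPrime.prod_right_iff.1 (squarefree_mul_iff.1 h).1 j (by simp [hij.symm])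

/-! ### Linear independence of the classes of the `∂_α` -/

theorem IsPartial.apply_ofDer {Q α g : S k} (hα : α ≠ 0) {d : algDer k (diffOps Q)}
    (hd : IsPartial Q α d) {δ : logDer Q} (hg : (δ : Derivation k (S k) (S k)) α = α * g) :
    d (ofDer Q δ) = ofPoly Q g := by
  obtain ⟨g', hg', h⟩ := hd.2 δ
  rw [h, mul_left_cancel₀ hα (hg'.symm.trans hg)]

theorem algDer_sum_smul_apply {A : Type*} [Ring A] [Algebra k A] {ι : Type*} (s : Finset ι)
    (c : ι → k) (d : ι → algDer k A) (a : A) : (∑ i ∈ s, c i • d i) a = ∑ i ∈ s, c i • d i a := by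
  simp only [Submodule.coe_sum, LinearMap.sum_apply, Submodule.coe_smul, LinearMap.smul_apply]

theorem sum_smul_partial_apply {ι : Type*} [Fintype ι] {Q : S k} {α : ι → S k}
    (h0 : ∀ i, α i ≠ 0) {d : ι → algDer k (diffOps Q)} (hd : ∀ i, IsPartial Q (α i) (d i))
    {δ : logDer Q} {g : ι → S k} (hg : ∀ i, (δ : Derivation k (S k) (S k)) (α i) = α i * g i)
    (c : ι → k) : (∑ i, c i • d i) (ofDer Q δ) = ofPoly Q (∑ i, C (c i) * g i) := by
  rw [algDer_sum_smul_apply, ofPoly_sum]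
  refine Finset.sum_congr rfl fun i _ => ?_
  rw [(hd i).apply_ofDer (h0 i) (hg i), ← smul_eq_C_mul, ofPoly_smul]

theorem sum_smul_partial_apply_ofPoly {ι : Type*} [Fintype ι] {Q : S k} {α : ι → S k}
    {d : ι → algDer k (diffOps Q)} (hd : ∀ i, IsPartial Q (α i) (d i))
    (c : ι → k) (f : S k) : (∑ i, c i • d i) (ofPoly Q f) = 0 := by
  rw [algDer_sum_smul_apply]
  exact Finset.sum_eq_zero fun i _ => by rw [(hd i).1, smul_zero]

theorem linearIndependent_mk {M ι : Type*} [AddCommGroup M] [Module k M] [Fintype ι]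
    (N : Submodule k M) {d : ι → M} (h : ∀ c : ι → k, ∑ i, c i • d i ∈ N → ∀ i, c i = 0) :
    LinearIndependent k (fun i => (Submodule.Quotient.mk (d i) : M ⧸ N)) := by
  refine Fintype.linearIndependent_iff.2 fun c hc => h c ?_
  rw [← Submodule.Quotient.mk_eq_zero, ← hc, ← Submodule.mkQ_apply, map_sum]
  simp only [map_smul, Submodule.mkQ_apply]

theorem span_range_mk_eq_top {M ι : Type*} [AddCommGroup M] [Module k M] [Fintype ι]
    (N : Submodule k M) {d : ι → M} (h : ∀ m : M, ∃ c : ι → k, m - ∑ i, c i • d i ∈ N) :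
    Submodule.span k (Set.range fun i => (Submodule.Quotient.mk (d i) : M ⧸ N)) = ⊤ := by
  refine (Submodule.eq_top_iff').2 fun z => ?_
  obtain ⟨m, rfl⟩ := Submodule.mkQ_surjective _ z
  obtain ⟨c, hc⟩ := h m
  refine (Submodule.mem_span_range_iff_exists_fun k).2 ⟨c, ?_⟩
  have h1 : N.mkQ (m - ∑ i, c i • d i) = 0 := (Submodule.Quotient.mk_eq_zero N).2 hc
  rw [map_sub, sub_eq_zero, map_sum] at h1
  rw [h1]
  simp only [map_smul, Submodule.mkQ_apply]

theorem linearIndependent_partial [CharZero k] {ι : Type*} [Fintype ι] [DecidableEq ι] {Q : S k}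
    {α : ι → S k} (hQ : Squarefree Q) (hα : ∀ i, (α i).IsHomogeneous 1) (hQdef : Q = ∏ i, α i)
    {d : ι → algDer k (diffOps Q)} (hd : ∀ i, IsPartial Q (α i) (d i)) :
    LinearIndependent k (fun i => (Submodule.Quotient.mk (d i) : HH1 k (diffOps Q))) := by
  have h0 : ∀ i, α i ≠ 0 := fun i =>
    Finset.prod_ne_zero_iff.1 (hQdef ▸ hQ.ne_zero) i (Finset.mem_univ i)
  have hQhom : Q.IsHomogeneous (∑ _i : ι, 1) :=
    hQdef ▸ IsHomogeneous.prod _ _ _ fun i _ => hα i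
  refine linearIndependent_mk _ fun c hc j => ?_
  obtain ⟨w, hw⟩ := hc
  have hcomm : w = ofPoly Q ((w : Module.End k (S k)) 1) := by
    refine eq_ofPoly_of_forall_commute fun f => ?_
    have h1 := sum_smul_partial_apply_ofPoly hd c f
    rw [hw, adDer_apply] at h1
    exact sub_eq_zero.1 h1
  set h := (w : Module.End k (S k)) 1
  have key : ∀ (δ : Derivation k (S k) (S k)), δ ∈ logDer Q → ∀ g : ι → S k,
      (∀ i, δ (α i) = α i * g i) → ∑ i, C (c i) * g i = - δ h := by
    intro δ hδ g hg
    have h1 := sum_smul_partial_apply h0 hd (δ := ⟨δ, hδ⟩) hg c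
    rw [hw, adDer_apply, hcomm] at h1
    have h2 := ofDer_commutator Q ⟨δ, hδ⟩ h
    have h3 := add_eq_zero_iff_eq_neg.1 (show ofPoly Q (∑ i, C (c i) * g i) +
      ofPoly Q (δ h) = 0 by rw [← h1, ← h2]; abel)
    refine ofPoly_injective Q ?_
    rw [h3, ← zero_sub (δ h), ofPoly_sub]
    have : ofPoly Q 0 = 0 := diffOps_ext fun p => by simp [ofPoly_coe_apply]
    rw [this, zero_sub]
  -- Each `∂_αᵢ` sends the Euler derivation to `1`, so `E(h)` is constant, and in characteristic
  -- zero so is `h`.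
  obtain ⟨e, he⟩ : ∃ e, h = C e := by
    have h1 := key _ (euler_mem_logDer hQhom) (fun _ => 1) fun i => by
      rw [euler_apply_of_isHomogeneous (hα i)]
      simp
    refine (exists_eq_C_of_euler_eq_C (c := -∑ i, c i) ?_).2
    rw [C_neg, map_sum, ← neg_eq_iff_eq_neg.2 h1]
    simp
  -- Testing on `Q ∂/∂αⱼ` gives a relation in which every term but the `j`-th is divisible by `αⱼ`.
  obtain ⟨Φ⟩ := nonempty_frame (hα j) (h0 j)
  have h1 := key _ (smul_mem_logDer Q Φ.dx)
    (fun i => (∏ l ∈ Finset.univ.erase i, α l) * Φ.dx (α i)) fun i => by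
      rw [Derivation.smul_apply, smul_eq_mul, hQdef,
        ← Finset.mul_prod_erase _ _ (Finset.mem_univ i), mul_assoc]
  rw [he, derivation_C, neg_zero, ← Finset.add_sum_erase _ _ (Finset.mem_univ j), Φ.dx_x,
    mul_one] at h1
  by_contra hcj
  have hdvd : α j ∣ ∏ l ∈ Finset.univ.erase j, α l := by
    have h2 : α j ∣ C (c j) * ∏ l ∈ Finset.univ.erase j, α l := by
      refine (dvd_add_left (Finset.dvd_sum fun i hi => ?_)).1 (h1 ▸ dvd_zero (α j))
      refine Dvd.dvd.mul_left (Dvd.dvd.mul_right (Finset.dvd_prod_of_mem _ ?_) _) _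
      simp [(Finset.ne_of_mem_erase hi).symm]
    exact (((isUnit_iff_ne_zero.2 hcj).map C).dvd_mul_left).1 h2
  rw [hQdef, ← Finset.mul_prod_erase _ _ (Finset.mem_univ j)] at hQ
  exact (prime_of_isHomogeneous_one (hα j) (h0 j)).not_isUnit
    ((squarefree_mul_iff.1 hQ).1 dvd_rfl hdvd)

/-! ### Derivations respect the filtrations by powers of the lines -/

theorem pow_dvd_diffOps_apply {Q α : S k} (hQ : Squarefree Q) (hα : α ∣ Q) (T : diffOps Q)
    {m : ℕ} : ∀ {p : S k}, α ^ m ∣ p → α ^ m ∣ (T : Module.End k (S k)) p := by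
  induction T using diffOps_induction with
  | poly f => exact fun h => h.mul_left f
  | der δ =>
    rintro _ ⟨q, rfl⟩
    rw [ofDer_coe_apply, Derivation.leibniz, Derivation.leibniz_pow]
    refine dvd_add (dvd_mul_right _ _) (Dvd.dvd.mul_left ?_ q)
    obtain ⟨g, hg⟩ := dvd_apply_of_mem_logDer hQ hα δ.2
    rw [hg]
    rcases m with _ | m
    · simp
    · refine ⟨((m + 1 : ℕ) : S k) * g, ?_⟩
      simp only [nsmul_eq_mul, smul_eq_mul, Nat.add_sub_cancel]
      ring
  | add a b ha hb => exact fun h => dvd_add (ha h) (hb h)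
  | mul a b ha hb => exact fun h => ha (hb h)

/-- The operator maps `αᵐ S` into `αᵐ⁺¹ S` for all `m`. -/
def Raises (Q α : S k) (T : diffOps Q) : Prop :=
  ∀ (m : ℕ) (p : S k), α ^ m ∣ p → α ^ (m + 1) ∣ (T : Module.End k (S k)) p

section Raises

variable {Q α : S k} {T U : diffOps Q}

theorem Raises.add (hT : Raises Q α T) (hU : Raises Q α U) : Raises Q α (T + U) :=
  fun m p h => dvd_add (hT m p h) (hU m p h)

theorem Raises.sub (hT : Raises Q α T) (hU : Raises Q α U) : Raises Q α (T - U) :=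
  fun m p h => dvd_sub (hT m p h) (hU m p h)

theorem Raises.mul_left (hQ : Squarefree Q) (hα : α ∣ Q) (U : diffOps Q) (hT : Raises Q α T) :
    Raises Q α (U * T) :=
  fun m p h => pow_dvd_diffOps_apply hQ hα U (hT m p h)

theorem Raises.mul_right (hQ : Squarefree Q) (hα : α ∣ Q) (U : diffOps Q) (hT : Raises Q α T) :
    Raises Q α (T * U) :=
  fun m _ h => hT m _ (pow_dvd_diffOps_apply hQ hα U h)

theorem raises_ofPoly_self : Raises Q α (ofPoly Q α) := fun m _ h => by
  rw [pow_succ', ofPoly_coe_apply]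
  exact mul_dvd_mul_left α h

theorem raises_zero : Raises Q α 0 := fun _ _ _ => dvd_zero _

theorem raises_commutator (hQ : Squarefree Q) (hα : α ∣ Q) (T : diffOps Q) :
    Raises Q α (T * ofPoly Q α - ofPoly Q α * T) := by
  induction T using diffOps_induction with
  | poly f =>
    rw [← ofPoly_mul, ← ofPoly_mul, mul_comm, sub_self]
    exact raises_zero
  | der δ =>
    rw [ofDer_commutator]
    obtain ⟨g, hg⟩ := dvd_apply_of_mem_logDer hQ hα δ.2
    rw [hg, mul_comm, ofPoly_mul]
    exact raises_ofPoly_self.mul_left hQ hα _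
  | add a b ha hb =>
    convert! ha.add hb using 1
    rw [add_mul, mul_add]
    abel
  | mul a b ha hb =>
    convert! (ha.mul_right hQ hα b).add (hb.mul_left hQ hα a) using 1
    noncomm_ring

end Raises

/-- Consider the action of `a = d(α)` on `αᵐ S / αᵐ⁺¹ S`. Applying `d` to `[f, α] = 0` shows that it
is `S`-linear, hence multiplication by some `h`. With `Q = αF` and `θ = Q ∂/∂α`, applying `d` to
`[θ, α] = αF` shows that `[θ, a]` and `aF` act equally. But `θ` acts as multiplication by `mF`, so
that bracket acts as zero; thus `α` divides `Fh`, and therefore `h`. -/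
theorem raises_apply_ofPoly {Q α : S k} (hQ : Squarefree Q) (hhom : α.IsHomogeneous 1)
    (hα : α ∣ Q) (d : algDer k (diffOps Q)) : Raises Q α (d (ofPoly Q α)) := by
  have h0 : α ≠ 0 := ne_zero_of_dvd_ne_zero hQ.ne_zero hα
  obtain ⟨Φ⟩ := nonempty_frame hhom h0
  obtain ⟨F, hF⟩ := id hα
  set a := d (ofPoly Q α) with ha
  have h1 : ∀ f, Raises Q α (ofPoly Q f * a - a * ofPoly Q f) := fun f => by
    have := algDer_commutator d (ofPoly Q f) (ofPoly Q α)
    rw [← ofPoly_mul, ← ofPoly_mul, mul_comm, sub_self, map_zero] at this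
    rw [eq_neg_of_add_eq_zero_right this.symm, ← zero_sub]
    exact raises_zero.sub (raises_commutator hQ hα _)
  set θ : logDer Q := ⟨Q • Φ.dx, smul_mem_logDer Q Φ.dx⟩
  have hθα : (θ : Derivation k (S k) (S k)) α = α * F := by
    change Q * Φ.dx α = _
    rw [Φ.dx_x, mul_one, hF]
  have h2 : Raises Q α (ofDer Q θ * a - a * ofDer Q θ - a * ofPoly Q F) := by
    have := algDer_commutator d (ofDer Q θ) (ofPoly Q α)
    rw [ofDer_commutator, hθα, ofPoly_mul, algDer_mul, ← ha] at this
    have h3 : ofDer Q θ * a - a * ofDer Q θ - a * ofPoly Q F = ofPoly Q α * d (ofPoly Q F) -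
        (d (ofDer Q θ) * ofPoly Q α - ofPoly Q α * d (ofDer Q θ)) := by
      rw [← eq_sub_iff_add_eq'] at this
      rw [this]
      abel
    rw [h3]
    exact (raises_ofPoly_self.mul_right hQ hα _).sub (raises_commutator hQ hα _)
  intro m
  obtain ⟨h, hh⟩ := pow_dvd_diffOps_apply hQ hα a (dvd_refl (α ^ m))
  have hpoly : ∀ f, α ^ (m + 1) ∣ f * (α ^ m * h) - (a : Module.End k (S k)) (f * α ^ m) :=
    fun f => by
      have := h1 f m _ (dvd_refl (α ^ m))
      rwa [← hh]
  have hθ : ∀ q, (θ : Derivation k (S k) (S k)) (α ^ m * q) =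
      α ^ (m + 1) * (F * Φ.dx q) + ((m : S k) * F) * (α ^ m * q) := fun q => by
    change Q * Φ.dx (α ^ m * q) = _
    rw [Derivation.leibniz, Derivation.leibniz_pow, Φ.dx_x, hF]
    rcases m with _ | m
    · simp
      ring
    · simp only [nsmul_eq_mul, smul_eq_mul, Nat.add_sub_cancel]
      ring
  have hdvd : α ^ (m + 1) ∣ F * (α ^ m * h) := by
    have h3 := h2 m _ (dvd_refl (α ^ m))
    have h4 : ((ofDer Q θ * a - a * ofDer Q θ - a * ofPoly Q F : diffOps Q) :
        Module.End k (S k)) (α ^ m) = (θ : Derivation k (S k) (S k)) (α ^ m * h) -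
        (a : Module.End k (S k)) ((θ : Derivation k (S k) (S k)) (α ^ m)) -
        (a : Module.End k (S k)) (F * α ^ m) := by
      rw [← hh]
      rfl
    have h5 := hθ 1
    rw [mul_one, Derivation.map_one_eq_zero, mul_zero, mul_zero, zero_add] at h5
    rw [h4, hθ, h5] at h3
    have h6 := dvd_sub (dvd_sub (dvd_sub h3 (hpoly ((m : S k) * F))) (hpoly F))
      (dvd_mul_right (α ^ (m + 1)) (F * Φ.dx h))
    rw [← dvd_neg]
    convert! h6 using 1
    ring
  have hh' : α ∣ h := by
    rw [pow_succ, mul_left_comm, mul_dvd_mul_iff_left (pow_ne_zero m h0), mul_comm] at hdvd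
    rw [hF] at hQ
    exact (squarefree_mul_iff.1 hQ).1.dvd_of_dvd_mul_right hdvd
  rintro _ ⟨q, rfl⟩
  have h7 := hpoly q
  rw [mul_comm q (α ^ m)] at h7
  refine (dvd_sub_right ?_).1 h7
  rw [pow_succ]
  exact (mul_dvd_mul_left _ hh').mul_left q

end Arrangement

/-! ### Inverting a finite difference -/

theorem exists_comp_sub_eq (k : Type*) [Field k] [CharZero k] (j : ℕ) :
    ∃ p : Polynomial k, p.comp (1 + Polynomial.X) - p = Polynomial.X ^ j := by
  -- Bernoulli polynomials satisfy `B_{j+1}(X + 1) - B_{j+1}(X) = (j + 1) Xʲ`.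
  refine ⟨Polynomial.C ((j + 1 : ℕ) : k)⁻¹ *
    (Polynomial.bernoulli (j + 1)).map (algebraMap ℚ k), ?_⟩
  have h := congrArg (Polynomial.map (algebraMap ℚ k)) (Polynomial.bernoulli_comp_one_add_X (j + 1))
  rw [Polynomial.map_comp, Polynomial.map_add, Polynomial.map_add, Polynomial.map_one,
    Polynomial.map_X, Nat.add_sub_cancel, nsmul_eq_mul, Polynomial.map_mul,
    Polynomial.map_natCast, Polynomial.map_pow, Polynomial.map_X] at h
  rw [Polynomial.mul_comp, Polynomial.C_comp, h, mul_add, add_sub_cancel_left, ← mul_assoc,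
    ← Polynomial.C_eq_natCast, ← Polynomial.C_mul,
    inv_mul_cancel₀ (Nat.cast_ne_zero.2 j.succ_ne_zero), Polynomial.C_1, one_mul]

theorem aeval_mul_eq_mul_aeval {k A : Type*} [Field k] [Ring A] [Algebra k A] {e x : A}
    (h : e * x = x * (1 + e)) (p : Polynomial k) :
    Polynomial.aeval e p * x = x * Polynomial.aeval e (p.comp (1 + Polynomial.X)) := by
  rw [Polynomial.aeval_comp]
  simp only [map_add, map_one, Polynomial.aeval_X]
  induction p using Polynomial.induction_on' with
  | add p q hp hq => rw [map_add, map_add, add_mul, mul_add, hp, hq]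
  | monomial n c =>
    have : e ^ n * x = x * (1 + e) ^ n := by
      induction n with
      | zero => simp
      | succ n ih => rw [pow_succ, mul_assoc, h, ← mul_assoc, ih, mul_assoc, ← pow_succ]
    rw [Polynomial.aeval_monomial, Polynomial.aeval_monomial, mul_assoc, this, ← mul_assoc,
      Algebra.commutes, mul_assoc]

theorem exists_aeval_commutator (k : Type*) {A : Type*} [Field k] [CharZero k] [Ring A]
    [Algebra k A] {e x : A} (h : e * x = x * (1 + e)) (j : ℕ) :
    ∃ p : Polynomial k, Polynomial.aeval e p * x - x * Polynomial.aeval e p = x * e ^ j := by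
  obtain ⟨p, hp⟩ := exists_comp_sub_eq k j
  refine ⟨p, ?_⟩
  rw [aeval_mul_eq_mul_aeval h, ← mul_sub, ← map_sub, hp, map_pow, Polynomial.aeval_X]

/-! ### The structure of `D(𝒜)` -/

/-- A factorization of `Q` with a chosen factor `x`, completed to a coordinate system. -/
structure SplitForm {k : Type u} [Field k] (Q : S k) (N : ℕ) where
  x : S k
  α : Fin N → S k
  x_hom : x.IsHomogeneous 1
  α_hom : ∀ i, (α i).IsHomogeneous 1
  eq_mul : Q = x * ∏ i, α i
  squarefree : Squarefree Q
  frame : Frame x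

namespace SplitForm

variable {k : Type u} [Field k] {Q : S k} {N : ℕ} (P : SplitForm Q N)

/-- The product of the factors other than `x`. -/
def F : S k := ∏ i, P.α i

/-- The derivation `F ∂/∂y`, which spans `Der(𝒜)` together with the Euler derivation. -/
def D : Derivation k (S k) (S k) := P.F • P.frame.dy

theorem Q_eq : Q = P.x * P.F := P.eq_mul

theorem x_ne_zero : P.x ≠ 0 := left_ne_zero_of_mul (P.Q_eq ▸ P.squarefree.ne_zero)

theorem x_prime : Prime P.x := prime_of_isHomogeneous_one P.x_hom P.x_ne_zero

theorem isRelPrime_x_F : IsRelPrime P.x P.F :=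
  (squarefree_mul_iff.1 (P.Q_eq ▸ P.squarefree)).1

theorem squarefree_F : Squarefree P.F := (squarefree_mul_iff.1 (P.Q_eq ▸ P.squarefree)).2.2

theorem F_ne_zero : P.F ≠ 0 := P.squarefree_F.ne_zero

theorem α_ne_zero (i : Fin N) : P.α i ≠ 0 :=
  Finset.prod_ne_zero_iff.1 P.F_ne_zero i (Finset.mem_univ i)

theorem α_prime (i : Fin N) : Prime (P.α i) :=
  prime_of_isHomogeneous_one (P.α_hom i) (P.α_ne_zero i)

theorem isRelPrime_α {i j : Fin N} (h : i ≠ j) : IsRelPrime (P.α i) (P.α j) :=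
  isRelPrime_of_squarefree_prod P.squarefree_F h

theorem isRelPrime_x_α (i : Fin N) : IsRelPrime P.x (P.α i) :=
  IsRelPrime.prod_right_iff.1 P.isRelPrime_x_F i (Finset.mem_univ i)

theorem F_eq (i : Fin N) : P.F = P.α i * ∏ j ∈ Finset.univ.erase i, P.α j :=
  (Finset.mul_prod_erase _ _ (Finset.mem_univ i)).symm

theorem F_hom : P.F.IsHomogeneous N := by
  have := IsHomogeneous.prod Finset.univ P.α (fun _ => 1) fun i _ => P.α_hom i
  simpa [F] using this

theorem x_dvd : P.x ∣ Q := ⟨_, P.Q_eq⟩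

theorem α_dvd (i : Fin N) : P.α i ∣ Q :=
  ((Finset.dvd_prod_of_mem _ (Finset.mem_univ i)).mul_left _).trans P.Q_eq.symm.dvd

theorem exists_α_eq (i : Fin N) :
    ∃ u v : k, v ≠ 0 ∧ P.α i = C u * P.x + C v * P.frame.y :=
  P.frame.exists_of_isRelPrime P.x_prime (P.α_hom i) (P.isRelPrime_x_α i)

/-- The coefficient of `y` in `αᵢ`. -/
def slope (i : Fin N) : k := (P.exists_α_eq i).choose_spec.choose

theorem slope_ne_zero (i : Fin N) : P.slope i ≠ 0 :=
  (P.exists_α_eq i).choose_spec.choose_spec.1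

theorem exists_α_eq_slope (i : Fin N) :
    ∃ u : k, P.α i = C u * P.x + C (P.slope i) * P.frame.y :=
  ⟨_, (P.exists_α_eq i).choose_spec.choose_spec.2⟩

theorem D_apply (p : S k) : P.D p = P.F * P.frame.dy p := rfl

theorem D_x : P.D P.x = 0 := by rw [D_apply, P.frame.dy_x, mul_zero]

theorem D_y : P.D P.frame.y = P.F := by rw [D_apply, P.frame.dy_y, mul_one]

theorem dy_α (i : Fin N) : P.frame.dy (P.α i) = C (P.slope i) := by
  obtain ⟨u, h⟩ := P.exists_α_eq_slope i
  rw [h]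
  simp [P.frame.dy_x, P.frame.dy_y]

theorem D_α (i : Fin N) :
    P.D (P.α i) = P.α i * (C (P.slope i) * ∏ j ∈ Finset.univ.erase i, P.α j) := by
  rw [D_apply, dy_α, P.F_eq i]
  ring

theorem D_mem : P.D ∈ logDer Q := by
  refine Ideal.mem_span_singleton.2 ?_
  rw [D_apply, congrArg P.frame.dy P.Q_eq, Derivation.leibniz, P.frame.dy_x, smul_zero, add_zero,
    smul_eq_mul, ← mul_assoc, mul_comm P.F]
  exact P.Q_eq.dvd.trans (dvd_mul_right _ _)

theorem euler_mem (P : SplitForm Q N) : euler k ∈ logDer Q :=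
  euler_mem_logDer (n := 1 + N) (P.Q_eq ▸ P.x_hom.mul P.F_hom)

theorem euler_D_apply (p : S k) :
    euler k (P.D p) = P.D (euler k p) + ((N : k) - 1) • P.D p := by
  have h : ⁅euler k, P.D⁆ = ((N : k) - 1) • P.D := by
    refine P.frame.derivation_ext ?_ ?_
    · rw [Derivation.commutator_apply, euler_apply_of_isHomogeneous P.x_hom]
      simp [P.D_x]
    · rw [Derivation.commutator_apply, euler_apply_of_isHomogeneous P.frame.y_hom]
      simp [P.D_y, euler_apply_of_isHomogeneous P.F_hom, sub_smul]
  have := congrArg (fun δ : Derivation k (S k) (S k) => δ p) h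
  simp only [Derivation.commutator_apply, Derivation.smul_apply] at this
  rw [← this]
  abel

/-- With `f = δ(x)/x`, the derivation `δ - fE` kills `x`; its value on `αᵢ` is then a non-zero
multiple of its value on `y`, which is therefore divisible by every `αᵢ`, hence by `F`. -/
theorem exists_eq_of_mem_logDer {δ : Derivation k (S k) (S k)} (hδ : δ ∈ logDer Q) :
    ∃ f g : S k, δ = f • euler k + g • P.D := by
  obtain ⟨f, hf⟩ := dvd_apply_of_mem_logDer P.squarefree P.x_dvd hδ
  have hE : ∀ {β : S k}, β.IsHomogeneous 1 → euler k β = β := fun hβ => by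
    rw [euler_apply_of_isHomogeneous hβ]
    simp
  have h1 : δ - f • euler k ∈ logDer Q := sub_mem hδ (Submodule.smul_mem _ f P.euler_mem)
  have h2 : P.F ∣ (δ - f • euler k) P.frame.y := by
    refine Finset.prod_dvd_of_isRelPrime (fun i _ j _ hij => P.isRelPrime_α hij) fun i _ => ?_
    obtain ⟨u, h⟩ := P.exists_α_eq_slope i
    have h3 := dvd_apply_of_mem_logDer P.squarefree (P.α_dvd i) h1
    have h4 : (δ - f • euler k) (P.α i) = C (P.slope i) * (δ - f • euler k) P.frame.y := by
      rw [h]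
      simp only [Derivation.sub_apply, Derivation.smul_apply, map_add, Derivation.leibniz,
        derivation_C, hf, hE P.x_hom, smul_eq_mul]
      ring
    rw [h4] at h3
    exact (((isUnit_iff_ne_zero.2 (P.slope_ne_zero i)).map C).dvd_mul_left).1 h3
  obtain ⟨g, hg⟩ := h2
  refine ⟨f, g, P.frame.derivation_ext ?_ ?_⟩
  · simp [hf, hE P.x_hom, P.D_x, mul_comm]
  · have h3 : (g • P.D) P.frame.y = P.F * g := by
      rw [Derivation.smul_apply, P.D_y, smul_eq_mul, mul_comm]
    rw [Derivation.add_apply, h3, ← hg, Derivation.sub_apply]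
    abel

theorem diffOps_le_normalOps (T : diffOps Q) :
    (T : Module.End k (S k)) ∈ normalOps P.D (euler k) := by
  -- Stability under left multiplication passes to products, unlike bare membership; it is then
  -- applied to the identity operator.
  suffices h : ∀ U ∈ normalOps P.D (euler k),
      (T : Module.End k (S k)) * U ∈ normalOps P.D (euler k) by
    have h1 := mul_pow_mem_normalOps (E := euler k)
      (Submodule.subset_span ⟨0, rfl⟩ : _ ∈ ops P.D) 0
    have := h _ h1
    simpa only [pow_zero, mul_one] using this
  induction T using diffOps_induction with
  | poly f => exact fun U hU => mulLeft_mul_mem_normalOps f hU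
  | der δ =>
    intro U hU
    obtain ⟨f, g, h⟩ := P.exists_eq_of_mem_logDer δ.2
    have h1 := add_mem (mulLeft_mul_mem_normalOps f (euler_mul_mem_normalOps P.euler_D_apply hU))
      (mulLeft_mul_mem_normalOps g (derivation_mul_mem_normalOps hU))
    convert! h1 using 1
    ext p
    simp [ofDer_coe_apply, h]
  | add a b ha hb =>
    intro U hU
    have := add_mem (ha U hU) (hb U hU)
    rwa [← add_mul] at this
  | mul a b ha hb =>
    intro U hU
    have := ha _ (hb U hU)
    rwa [← mul_assoc] at this

/-- The Euler derivation as an element of `D(𝒜)`. -/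
def opE : diffOps Q := ofDer Q ⟨euler k, P.euler_mem⟩

/-- The derivation `F ∂/∂y` as an element of `D(𝒜)`. -/
def opD : diffOps Q := ofDer Q ⟨P.D, P.D_mem⟩

theorem opE_mul_opD :
    P.opE * P.opD - P.opD * P.opE = ((N : k) - 1) • P.opD := by
  rw [sub_eq_iff_eq_add']
  exact diffOps_ext fun p => P.euler_D_apply p

theorem opE_mul_x : P.opE * ofPoly Q P.x = ofPoly Q P.x * (1 + P.opE) := by
  have h := ofDer_commutator Q ⟨euler k, P.euler_mem⟩ P.x
  rw [euler_apply_of_isHomogeneous P.x_hom, Nat.cast_one, one_smul, sub_eq_iff_eq_add] at h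
  rw [mul_add, mul_one]
  exact h

theorem mem_diffOps_of_mem_ops {T : Module.End k (S k)} (hT : T ∈ ops P.D) : T ∈ diffOps Q := by
  induction hT using Submodule.span_induction with
  | mem a ha =>
    obtain ⟨i, rfl⟩ := ha
    exact pow_mem P.opD.2 i
  | zero => exact zero_mem _
  | add a b _ _ ha hb => exact add_mem ha hb
  | smul f a _ ha => exact mul_mem (ofPoly Q f).2 ha

theorem euler_pow_apply {p : S k} {n : ℕ} (hp : p.IsHomogeneous n) (j : ℕ) :
    ((((euler k : S k →ₗ[k] S k) : Module.End k (S k)) ^ j) p) = (n : k) ^ j • p := by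
  induction j with
  | zero => simp
  | succ j ih =>
    rw [pow_succ, Module.End.mul_apply, Derivation.coeFn_coe, euler_apply_of_isHomogeneous hp,
      map_smul, ih, smul_smul, pow_succ']

/-- `E` acts on degree `m + n` by a scalar and operators in `D` commute with `x`, so the exponent
`m` becomes a free parameter separating the coefficients `a j`. -/
theorem sum_ops_apply (s : Finset ℕ) {a : ℕ → Module.End k (S k)} (ha : ∀ j, a j ∈ ops P.D)
    {p : S k} {n : ℕ} (hp : p.IsHomogeneous n) (m : ℕ) :
    (∑ j ∈ s, a j * ((euler k : S k →ₗ[k] S k) : Module.End k (S k)) ^ j) (P.x ^ m * p) =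
      P.x ^ m * ∑ j ∈ s, ((m + n : ℕ) : k) ^ j • a j p := by
  have hq : (P.x ^ m * p).IsHomogeneous (m + n) := by
    have := (P.x_hom.pow m).mul hp
    rwa [one_mul] at this
  rw [LinearMap.sum_apply, Finset.mul_sum]
  refine Finset.sum_congr rfl fun j _ => ?_
  rw [Module.End.mul_apply, euler_pow_apply hq, map_smul, ops_apply_pow_mul P.D P.D_x (ha j),
    mul_smul_comm]

theorem D_F : P.D P.F = P.F * P.frame.dy P.F := rfl

theorem not_x_dvd_F : ¬ P.x ∣ P.F := fun h => P.x_prime.not_isUnit (P.isRelPrime_x_F dvd_rfl h)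

/-! ### Normalizing a derivation at `x` -/

variable [CharZero k]

/-- Up to an inner derivation, a derivation of `D(𝒜)` vanishes at `x`. -/
theorem exists_adDer_apply_x (d : algDer k (diffOps Q)) :
    ∃ u : diffOps Q, d (ofPoly Q P.x) = adDer k _ u (ofPoly Q P.x) := by
  have hraise := raises_apply_ofPoly P.squarefree P.x_hom P.x_dvd d
  set T := d (ofPoly Q P.x)
  obtain ⟨s, a, -, ha, hT⟩ := exists_sum_of_mem_normalOps (P.diffOps_le_normalOps T)
  -- Since `T` raises the `x`-adic filtration, `x` divides `∑ (m + n)ʲ aⱼ p` for all `m`, hence each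
  -- `aⱼ p`.
  have hdvd_hom : ∀ j ∈ s, ∀ (n : ℕ) (p : S k), p.IsHomogeneous n → P.x ∣ a j p := by
    intro j hj n p hp
    have := coeff_mem_of_forall_sum_mem ((Ideal.span {P.x}).restrictScalars k) s
      (fun j => a j p) n (fun m => ?_) j hj
    · exact Ideal.mem_span_singleton.1 this
    · have h1 := hraise m _ (dvd_mul_right (P.x ^ m) p)
      rw [hT, P.sum_ops_apply s ha hp, pow_succ,
        mul_dvd_mul_iff_left (pow_ne_zero m P.x_ne_zero)] at h1
      exact Ideal.mem_span_singleton.2 h1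
  have hdvd : ∀ j ∈ s, ∀ p, P.x ∣ a j p := by
    intro j hj p
    rw [← sum_homogeneousComponent p, map_sum]
    exact Finset.dvd_sum fun i _ => hdvd_hom j hj i _ (homogeneousComponent_isHomogeneous i p)
  have hb : ∀ j, ∃ b ∈ ops P.D, j ∈ s → a j = P.x • b := by
    intro j
    by_cases hj : j ∈ s
    · obtain ⟨n, hn⟩ := exists_mem_opsLT P.D (ha j)
      obtain ⟨b, hb, h⟩ := exists_smul_of_forall_dvd_apply P.x_prime P.not_x_dvd_F P.D_y P.D_F hn
        (hdvd j hj)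
      exact ⟨b, opsLT_le_ops P.D n hb, fun _ => h⟩
    · exact ⟨0, zero_mem _, fun h => absurd h hj⟩
  choose b hb hab using hb
  choose q hq using exists_aeval_commutator k P.opE_mul_x
  let B : ℕ → diffOps Q := fun j => ⟨b j, P.mem_diffOps_of_mem_ops (hb j)⟩
  have hBx : ∀ j, B j * ofPoly Q P.x = ofPoly Q P.x * B j := fun j =>
    diffOps_ext fun p => ops_apply_mul P.D P.D_x (hb j) p
  -- As `B j` commutes with `x`, the bracket of `B j * q j (E)` with `x` is `x * B j * Eʲ`.
  refine ⟨∑ j ∈ s, B j * Polynomial.aeval P.opE (q j), ?_⟩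
  have hTB : T = ∑ j ∈ s, ofPoly Q P.x * (B j * P.opE ^ j) := by
    refine Subtype.ext ?_
    rw [hT, AddSubmonoidClass.coe_finsetSum]
    refine Finset.sum_congr rfl fun j hj => ?_
    rw [hab j hj]
    rfl
  rw [adDer_apply, Finset.sum_mul, Finset.mul_sum, ← Finset.sum_sub_distrib, hTB]
  refine Finset.sum_congr rfl fun j _ => ?_
  rw [← mul_assoc, ← hBx, mul_assoc, ← hq, mul_sub, ← mul_assoc, ← mul_assoc, ← mul_assoc, ← hBx]

/-- Operators in `D(𝒜)` that commute with `x` are polynomials in `F ∂/∂y`. -/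
theorem mem_ops_of_commute {T : diffOps Q} (hT : T * ofPoly Q P.x = ofPoly Q P.x * T) :
    (T : Module.End k (S k)) ∈ ops P.D := by
  obtain ⟨s, a, h0, ha, hTa⟩ := exists_sum_of_mem_normalOps (P.diffOps_le_normalOps T)
  have hpow : ∀ (m : ℕ) (p : S k), (T : Module.End k (S k)) (P.x ^ m * p) =
      P.x ^ m * (T : Module.End k (S k)) p := by
    intro m p
    induction m with
    | zero => simp
    | succ m ih =>
      have := congrArg (fun U : diffOps Q => (U : Module.End k (S k)) (P.x ^ m * p)) hT
      simp only [diffOps_coe_mul_apply, ofPoly_coe_apply, ih] at this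
      rw [pow_succ', mul_assoc, this, mul_assoc]
  have hhom : ∀ (n : ℕ) (p : S k), p.IsHomogeneous n → (T : Module.End k (S k)) p = a 0 p := by
    intro n p hp
    -- `T p = ∑ (m + n)ʲ aⱼ p` does not depend on `m`. Moving `T p` into the coefficient of index
    -- `0` gives a family vanishing for all `m`.
    have := coeff_mem_of_forall_sum_mem (⊥ : Submodule k (S k)) s
      (fun j => a j p - if j = 0 then (T : Module.End k (S k)) p else 0) n (fun m => ?_) 0 h0
    · rw [if_pos rfl, Submodule.mem_bot, sub_eq_zero] at this
      exact this.symm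
    · have h1 := hpow m p
      conv_lhs at h1 => rw [hTa]
      rw [P.sum_ops_apply s ha hp] at h1
      have h2 := mul_left_cancel₀ (pow_ne_zero m P.x_ne_zero) h1
      rw [Submodule.mem_bot]
      simp only [smul_sub, Finset.sum_sub_distrib, smul_ite, smul_zero, Finset.sum_ite_eq', h0,
        if_true, pow_zero, one_smul, h2, sub_self]
  have : (T : Module.End k (S k)) = a 0 := LinearMap.ext fun p => by
    rw [← sum_homogeneousComponent p, map_sum, map_sum]
    exact Finset.sum_congr rfl fun i _ => hhom i _ (homogeneousComponent_isHomogeneous i p)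
  rw [this]
  exact ha 0

end SplitForm

/-! ### Normalizing at `y` and on `Der(𝒜)`, and spanning by the `∂_α` -/

namespace SplitForm

variable {k : Type u} [Field k] {Q : S k} {N : ℕ} (P : SplitForm Q N)

theorem D_pow_apply_α_pow (i : Fin N) (j m : ℕ) :
    ∃ t : S k, (((P.D : S k →ₗ[k] S k) : Module.End k (S k)) ^ j) (P.α i ^ m) =
      P.α i ^ m * (((m : S k) * (C (P.slope i) * ∏ l ∈ Finset.univ.erase i, P.α l)) ^ j +
        P.α i * t) := by
  induction j with
  | zero => exact ⟨0, by simp⟩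
  | succ j ih =>
    obtain ⟨t, ht⟩ := ih
    set G := C (P.slope i) * ∏ l ∈ Finset.univ.erase i, P.α l with hG
    set q := ((m : S k) * G) ^ j + P.α i * t with hq
    have h1 : P.D (P.α i ^ m) = P.α i ^ m * ((m : S k) * G) := by
      rw [Derivation.leibniz_pow, P.D_α, ← hG]
      rcases m with _ | m
      · simp
      · simp only [nsmul_eq_mul, smul_eq_mul, Nat.add_sub_cancel]
        ring
    refine ⟨(m : S k) * G * t + (∏ l ∈ Finset.univ.erase i, P.α l) * P.frame.dy q, ?_⟩
    rw [pow_succ', Module.End.mul_apply, ht, Derivation.coeFn_coe, Derivation.leibniz, h1,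
      P.D_apply, P.F_eq i]
    simp only [smul_eq_mul]
    rw [hq]
    ring

theorem α_not_dvd_prod_erase (i : Fin N) : ¬ P.α i ∣ ∏ l ∈ Finset.univ.erase i, P.α l := by
  intro h
  have := P.squarefree_F
  rw [P.F_eq i] at this
  exact (P.α_prime i).not_isUnit ((squarefree_mul_iff.1 this).1 dvd_rfl h)

/-- Modulo `αᵢᵐ⁺¹`, `Dʲ(αᵢᵐ)` is `αᵢᵐ (mG)ʲ` with `G` prime to `αᵢ`. Letting `m` vary separates the
`cⱼ Gʲ`, each of which is divisible by `αᵢ`. -/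
theorem α_dvd_coeff [CharZero k] {T : diffOps Q} (i : Fin N) (hT : Raises Q (P.α i) T) {n : ℕ} {c : ℕ → S k}
    (hc : (T : Module.End k (S k)) = ∑ j ∈ Finset.range n,
      c j • ((P.D : S k →ₗ[k] S k) : Module.End k (S k)) ^ j) :
    ∀ j ∈ Finset.range n, P.α i ∣ c j := by
  intro j hj
  set G := C (P.slope i) * ∏ l ∈ Finset.univ.erase i, P.α l with hG
  have h1 := coeff_mem_of_forall_sum_mem ((Ideal.span {P.α i}).restrictScalars k)
    (Finset.range n) (fun j => c j * G ^ j) 0 (fun m => ?_) j hj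
  · have h2 : P.α i ∣ c j * G ^ j := Ideal.mem_span_singleton.1 h1
    refine ((P.α_prime i).dvd_or_dvd h2).resolve_right fun h3 => ?_
    have h4 := (P.α_prime i).dvd_of_dvd_pow h3
    exact P.α_not_dvd_prod_erase i
      ((((isUnit_iff_ne_zero.2 (P.slope_ne_zero i)).map C).dvd_mul_left).1 h4)
  · choose t ht using fun j => P.D_pow_apply_α_pow i j m
    have h2 := hT m _ dvd_rfl
    have h3 : (T : Module.End k (S k)) (P.α i ^ m) = P.α i ^ m *
        (∑ j ∈ Finset.range n, (((m + 0 : ℕ) : k) ^ j • (c j * G ^ j)) +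
          P.α i * ∑ j ∈ Finset.range n, c j * t j) := by
      rw [hc, LinearMap.sum_apply, Finset.mul_sum _ _ (P.α i),
        ← Finset.sum_add_distrib, Finset.mul_sum]
      refine Finset.sum_congr rfl fun j _ => ?_
      rw [LinearMap.smul_apply, ht, ← hG, smul_eq_mul, smul_eq_C_mul, add_zero, mul_pow, C_pow,
        map_natCast]
      ring
    rw [h3, pow_succ, mul_dvd_mul_iff_left (pow_ne_zero m (P.α_ne_zero i))] at h2
    exact Ideal.mem_span_singleton.2 ((dvd_add_left (dvd_mul_right _ _)).1 h2)

/-- Up to an inner derivation, a derivation of `D(𝒜)` that vanishes at `x` vanishes at `y`. -/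
theorem exists_adDer_apply_y [CharZero k] {d : algDer k (diffOps Q)} (hd : d (ofPoly Q P.x) = 0) :
    ∃ u : diffOps Q, adDer k _ u (ofPoly Q P.x) = 0 ∧
      d (ofPoly Q P.frame.y) = adDer k _ u (ofPoly Q P.frame.y) := by
  set T := d (ofPoly Q P.frame.y) with hTdef
  have hcomm : T * ofPoly Q P.x = ofPoly Q P.x * T := by
    have := algDer_commutator d (ofPoly Q P.frame.y) (ofPoly Q P.x)
    rw [hd, ← ofPoly_mul, ← ofPoly_mul, mul_comm, sub_self, map_zero, mul_zero, zero_mul,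
      sub_zero, add_zero] at this
    exact (sub_eq_zero.1 this.symm)
  obtain ⟨n, hn⟩ := exists_mem_opsLT P.D (P.mem_ops_of_commute hcomm)
  obtain ⟨c, hc⟩ := exists_range_sum_of_mem_opsLT P.D hn
  have hraise : ∀ i, Raises Q (P.α i) T := fun i => by
    obtain ⟨w, h⟩ := P.exists_α_eq_slope i
    have h1 := raises_apply_ofPoly P.squarefree (P.α_hom i) (P.α_dvd i) d
    have h2 : d (ofPoly Q (P.α i)) = P.slope i • T := by
      rw [h, ← smul_eq_C_mul, ← smul_eq_C_mul, ofPoly_add, ofPoly_smul, ofPoly_smul, map_add,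
        map_smul, map_smul, hd, smul_zero, zero_add]
    intro m p hp
    have h3 := h1 m p hp
    rw [h2] at h3
    change P.α i ^ (m + 1) ∣ P.slope i • (T : Module.End k (S k)) p at h3
    rw [smul_eq_C_mul] at h3
    exact (((isUnit_iff_ne_zero.2 (P.slope_ne_zero i)).map C).dvd_mul_left).1 h3
  have hF : ∀ j, ∃ e : S k, j ∈ Finset.range n → c j = P.F * e := by
    intro j
    by_cases hj : j ∈ Finset.range n
    · obtain ⟨e, he⟩ : P.F ∣ c j := Finset.prod_dvd_of_isRelPrime
        (fun i _ l _ hil => P.isRelPrime_α hil) fun i _ => P.α_dvd_coeff i (hraise i) hc j hj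
      exact ⟨e, fun _ => he⟩
    · exact ⟨0, fun h => absurd h hj⟩
  choose e he using hF
  obtain ⟨w, hw, h⟩ := exists_adPoly_eq P.D_y P.D_F (n := n)
    (T := ∑ j ∈ Finset.range n, e j • ((P.D : S k →ₗ[k] S k) : Module.End k (S k)) ^ j)
    (sum_mem fun j hj => Submodule.smul_mem _ _ (pow_mem_opsLT P.D (Finset.mem_range.1 hj)))
  have hw' := opsLT_le_ops P.D _ hw
  refine ⟨⟨w, P.mem_diffOps_of_mem_ops hw'⟩, ?_, ?_⟩
  · rw [adDer_apply, sub_eq_zero]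
    exact diffOps_ext fun p => ops_apply_mul P.D P.D_x hw' p
  · refine Subtype.ext ?_
    rw [hc, Finset.sum_congr rfl fun j hj => by rw [he j hj, ← smul_smul], ← Finset.smul_sum, ← h]
    rfl

theorem apply_ofPoly_eq_zero {d : algDer k (diffOps Q)} (hx : d (ofPoly Q P.x) = 0)
    (hy : d (ofPoly Q P.frame.y) = 0) (f : S k) : d (ofPoly Q f) = 0 := by
  induction f using MvPolynomial.induction_on with
  | C a => rw [ofPoly_C, algDer_algebraMap]
  | add p q hp hq => rw [ofPoly_add, map_add, hp, hq, add_zero]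
  | mul_X p i hp =>
    obtain ⟨w, v, h⟩ := P.frame.span (X i) (isHomogeneous_X k i)
    rw [ofPoly_mul, algDer_mul, hp, zero_mul, zero_add, h, ← smul_eq_C_mul, ← smul_eq_C_mul,
      ofPoly_add, ofPoly_smul, ofPoly_smul, map_add, map_smul, map_smul, hx, hy, smul_zero,
      smul_zero, add_zero, mul_zero]

theorem exists_apply_eq_ofPoly {d : algDer k (diffOps Q)} (hd : ∀ f, d (ofPoly Q f) = 0)
    (δ : logDer Q) : ∃ g, d (ofDer Q δ) = ofPoly Q g := by
  refine ⟨_, eq_ofPoly_of_forall_commute fun f => ?_⟩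
  have := algDer_commutator d (ofDer Q δ) (ofPoly Q f)
  rw [ofDer_commutator, hd, hd, mul_zero, zero_mul, sub_zero, add_zero] at this
  exact sub_eq_zero.1 this.symm

theorem algDer_ext' {d e : algDer k (diffOps Q)} (hd : ∀ f, d (ofPoly Q f) = e (ofPoly Q f))
    (hE : d P.opE = e P.opE) (hD : d P.opD = e P.opD) : d = e := by
  refine algDer_ext hd fun δ => ?_
  obtain ⟨f, g, h⟩ := P.exists_eq_of_mem_logDer δ.2
  have : ofDer Q δ = ofPoly Q f * P.opE + ofPoly Q g * P.opD := by
    rw [opE, opD, ← ofDer_smul, ← ofDer_smul, ← ofDer_add]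
    exact congrArg _ (Subtype.ext h)
  rw [this, map_add, map_add, algDer_mul, algDer_mul, algDer_mul, algDer_mul, hd, hd, hE, hD]

/-- Up to an inner derivation, a derivation of `D(𝒜)` vanishes on polynomials and maps the Euler
derivation to a constant. -/
theorem exists_sub_adDer_normalized [CharZero k] (d : algDer k (diffOps Q)) :
    ∃ (w : diffOps Q) (c : k), (∀ f, (d - adDer k _ w) (ofPoly Q f) = 0) ∧
      (d - adDer k _ w) P.opE = ofPoly Q (C c) := by
  obtain ⟨w₁, h₁⟩ := P.exists_adDer_apply_x d
  have hx : (d - adDer k _ w₁) (ofPoly Q P.x) = 0 := sub_eq_zero.2 h₁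
  obtain ⟨w₂, h₂, h₂'⟩ := P.exists_adDer_apply_y hx
  have h3 : ∀ f, (d - adDer k _ (w₁ + w₂)) (ofPoly Q f) = 0 :=
    P.apply_ofPoly_eq_zero
      (by rw [sub_adDer_add_apply, hx, ← adDer_apply (k := k), h₂, sub_zero])
      (by rw [sub_adDer_add_apply, h₂', ← adDer_apply (k := k), sub_self])
  obtain ⟨e, he⟩ := exists_apply_eq_ofPoly h3 ⟨euler k, P.euler_mem⟩
  -- The bracket of `-h` with `E` is `E(h) = e - c`, so removing it leaves the constant.
  obtain ⟨h, c, hh⟩ := exists_euler_eq e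
  refine ⟨w₁ + w₂ + ofPoly Q (-h), c, fun f => ?_, ?_⟩
  · rw [sub_adDer_add_apply, h3, ← ofPoly_mul, ← ofPoly_mul, mul_comm, sub_self, sub_zero]
  · have h5 := ofDer_commutator Q ⟨euler k, P.euler_mem⟩ (-h)
    rw [map_neg, hh, neg_sub] at h5
    rw [sub_adDer_add_apply, opE, he, ← neg_sub (_ * ofPoly Q (-h)), h5, sub_neg_eq_add,
      ← ofPoly_add, add_sub_cancel]

theorem exists_eq_sum_of_euler [CharZero k] {g : S k} (hg : euler k g = ((N : k) - 1) • g) :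
    ∃ γ : Fin N → k, g = ∑ i, C (γ i) * ∏ j ∈ Finset.univ.erase i, P.α j := by
  -- For `N = 0` the weight is `-1`, and no non-zero polynomial has it.
  rcases N with _ | n
  · refine ⟨0, ?_⟩
    rw [eq_zero_of_euler_eq_neg (g := g) (by simpa using hg)]
    simp
  · refine exists_eq_sum_prod_erase (β := P.x) (n := n) (by simp) (fun i _ => P.α_hom i)
      (fun i _ => P.α_ne_zero i) (fun i _ j _ hij => P.isRelPrime_α hij) (fun i _ l hl => ?_)
      (isHomogeneous_of_euler (by simpa using hg))
    obtain ⟨p, q, rfl⟩ := P.frame.span l hl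
    obtain ⟨w, hw⟩ := P.exists_α_eq_slope i
    refine ⟨q / P.slope i, p - q / P.slope i * w, ?_⟩
    have h8 : (C q : S k) = C (q / P.slope i) * C (P.slope i) := by
      rw [← C_mul, div_mul_cancel₀ _ (P.slope_ne_zero i)]
    rw [hw, C_sub, C_mul]
    linear_combination P.frame.y * h8

/-- Apply `d` to `[E, D] = (N - 1) D`: as `d(E)` is central, `d(D)` has Euler weight `N - 1`. -/
theorem exists_apply_opD [CharZero k] {d : algDer k (diffOps Q)} (hd : ∀ f, d (ofPoly Q f) = 0) {c : k}
    (hE : d P.opE = ofPoly Q (C c)) :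
    ∃ γ : Fin N → k,
      d P.opD = ofPoly Q (∑ i, C (γ i) * ∏ j ∈ Finset.univ.erase i, P.α j) := by
  obtain ⟨g, hg⟩ := exists_apply_eq_ofPoly hd ⟨P.D, P.D_mem⟩
  change d P.opD = ofPoly Q g at hg
  have hg' : euler k g = ((N : k) - 1) • g := by
    have h5 := algDer_commutator d P.opE P.opD
    have h6 := ofDer_commutator Q ⟨euler k, P.euler_mem⟩ g
    rw [P.opE_mul_opD, map_smul, hE, hg, ofPoly_C, Algebra.commutes, sub_self, zero_add, opE, h6,
      ← ofPoly_smul] at h5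
    exact (ofPoly_injective Q h5).symm
  obtain ⟨γ, rfl⟩ := P.exists_eq_sum_of_euler hg'
  exact ⟨γ, hg⟩

/-- `∂_x` kills `D`, so the value at `D` dictates the coefficients `γᵢ / slope i`. Every `∂_α` takes
`E` to `1`, whence the correction in the coefficient of `∂_x`. -/
theorem eq_sum_partial {d : algDer k (diffOps Q)} (hd : ∀ f, d (ofPoly Q f) = 0) {c : k}
    (hE : d P.opE = ofPoly Q (C c)) {γ : Fin N → k}
    (hD : d P.opD = ofPoly Q (∑ i, C (γ i) * ∏ j ∈ Finset.univ.erase i, P.α j))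
    {d₀ : algDer k (diffOps Q)} (hd₀ : IsPartial Q P.x d₀)
    {d₁ : Fin N → algDer k (diffOps Q)} (hd₁ : ∀ i, IsPartial Q (P.α i) (d₁ i)) :
    d = (c - ∑ i, γ i / P.slope i) • d₀ + ∑ i, (γ i / P.slope i) • d₁ i := by
  have hone : ∀ {β : S k}, β.IsHomogeneous 1 → euler k β = β * 1 := fun hβ => by
    rw [euler_apply_of_isHomogeneous hβ]
    simp
  have h1 := fun f => sum_smul_partial_apply_ofPoly hd₁ (fun i => γ i / P.slope i) f
  have h2 := sum_smul_partial_apply P.α_ne_zero hd₁ (δ := ⟨euler k, P.euler_mem⟩)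
    (fun i => hone (P.α_hom i)) fun i => γ i / P.slope i
  have h3 := sum_smul_partial_apply P.α_ne_zero hd₁ (δ := ⟨P.D, P.D_mem⟩) P.D_α
    fun i => γ i / P.slope i
  generalize ∑ i, (γ i / P.slope i) • d₁ i = σ at h1 h2 h3 ⊢
  have h4 := hd₀.apply_ofDer (δ := ⟨euler k, P.euler_mem⟩) P.x_ne_zero (hone P.x_hom)
  have h5 := hd₀.apply_ofDer (δ := ⟨P.D, P.D_mem⟩) (g := 0) P.x_ne_zero
    (P.D_x.trans (mul_zero _).symm)
  refine P.algDer_ext' (fun f => ?_) ?_ ?_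
  · rw [algDer_add_apply, algDer_smul_apply, hd, hd₀.1, h1, smul_zero, add_zero]
  · rw [hE, algDer_add_apply, algDer_smul_apply, opE, h4, h2, ← ofPoly_smul, ← ofPoly_add]
    congr 1
    simp [smul_eq_C_mul]
  · rw [hD, algDer_add_apply, algDer_smul_apply, opD, h5, h3, ← ofPoly_smul, ← ofPoly_add,
      smul_zero, zero_add]
    refine congrArg _ (Finset.sum_congr rfl fun i _ => ?_)
    rw [← mul_assoc, ← C_mul, div_mul_cancel₀ _ (P.slope_ne_zero i)]

theorem exists_sub_adDer_eq_sum_partial [CharZero k] (d : algDer k (diffOps Q))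
    {d₀ : algDer k (diffOps Q)} (hd₀ : IsPartial Q P.x d₀)
    {d₁ : Fin N → algDer k (diffOps Q)} (hd₁ : ∀ i, IsPartial Q (P.α i) (d₁ i)) :
    ∃ (w : diffOps Q) (c : k) (γ : Fin N → k),
      d - adDer k _ w = c • d₀ + ∑ i, γ i • d₁ i := by
  obtain ⟨w, c, h, hE⟩ := P.exists_sub_adDer_normalized d
  obtain ⟨γ, hD⟩ := P.exists_apply_opD h hE
  exact ⟨w, _, _, P.eq_sum_partial h hE hD hd₀ hd₁⟩

theorem exists_sub_sum_mem_innerDer [CharZero k] {d : Fin (N + 1) → algDer k (diffOps Q)}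
    (hd₀ : IsPartial Q P.x (d 0)) (hd₁ : ∀ i, IsPartial Q (P.α i) (d i.succ))
    (e : algDer k (diffOps Q)) :
    ∃ c : Fin (N + 1) → k, e - ∑ i, c i • d i ∈ innerDer k (diffOps Q) := by
  obtain ⟨w, c, γ, h⟩ := P.exists_sub_adDer_eq_sum_partial e hd₀ hd₁
  exact LineArrangement.exists_sub_sum_mem_innerDer h

end SplitForm

theorem span_partial_eq_top {k : Type u} [Field k] [CharZero k] {Q : S k} {n : ℕ} (hn : n ≠ 0)
    {α : Fin n → S k} (hQ : Squarefree Q) (hα : ∀ i, (α i).IsHomogeneous 1)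
    (hQα : Q = ∏ i, α i) {d : Fin n → algDer k (diffOps Q)} (hd : ∀ i, IsPartial Q (α i) (d i)) :
    Submodule.span k (Set.range fun i =>
      (Submodule.Quotient.mk (d i) : HH1 k (diffOps Q))) = ⊤ := by
  obtain ⟨N, rfl⟩ := Nat.exists_eq_succ_of_ne_zero hn
  have h0 : α 0 ≠ 0 :=
    Finset.prod_ne_zero_iff.1 (hQα ▸ hQ.ne_zero) 0 (Finset.mem_univ 0)
  obtain ⟨Φ⟩ := nonempty_frame (hα 0) h0
  let P : SplitForm Q N := ⟨α 0, fun i => α i.succ, hα 0, fun i => hα i.succ,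
    by rw [hQα, Fin.prod_univ_succ], hQ, Φ⟩
  exact span_range_mk_eq_top _ (P.exists_sub_sum_mem_innerDer (hd 0) fun i => hd i.succ)

end LineArrangement

end

theorem mainTheorem2 {k : Type*} [Field k] [CharZero k]
    (𝒜 : LineArrangement.CentralArrangement k) (h𝒜 : 𝒜.lines.Nonempty)
    (Q : LineArrangement.S k) (hQ : 𝒜.IsDefiningPolynomial Q) :
    (∀ α : LineArrangement.S k, α.IsHomogeneous 1 → α ≠ 0 → α ∣ Q →
      ∃! d : LineArrangement.algDer k (LineArrangement.diffOps Q),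
        LineArrangement.IsPartial Q α d) ∧
    (∀ α : Fin 𝒜.lines.card → LineArrangement.S k,
      (∀ i, (α i).IsHomogeneous 1) → Q = ∏ i, α i →
      ∀ d : Fin 𝒜.lines.card → LineArrangement.algDer k (LineArrangement.diffOps Q),
        (∀ i, LineArrangement.IsPartial Q (α i) (d i)) →
        LinearIndependent k (fun i =>
          (Submodule.Quotient.mk (d i) : LineArrangement.HH1 k (LineArrangement.diffOps Q))) ∧
        Submodule.span k (Set.range fun i =>
          (Submodule.Quotient.mk (d i) : LineArrangement.HH1 k (LineArrangement.diffOps Q)))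
            = ⊤) := by
  refine ⟨fun α _ h0 hα => ?_, fun α hα hQα d hd =>
    ⟨LineArrangement.linearIndependent_partial hQ.squarefree hα hQα hd,
      LineArrangement.span_partial_eq_top (Finset.card_ne_zero.2 h𝒜) hQ.squarefree hα hQα hd⟩⟩
  obtain ⟨d, hd⟩ := LineArrangement.exists_isPartial hQ.squarefree hα
  exact ⟨d, hd, fun e he => he.unique h0 hd⟩
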